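/- Let $k$ be a field and $A$ a finite-dimensional $k$-algebra; all $A$-modules considered are finitely generated left modules. Let $(\Lambda,\leqslant)$ be a finite poset, with height function $h$ (minimal elements of $\Lambda$ have height $1$, the minimal elements among the remaining ones height $2$, and so on). Let $\underline\Theta=\{\Theta_\lambda\}_{\lambda\in\Lambda}$ be nonzero $A$-modules and $\underline Q=\{Q_\lambda\}_{\lambda\in\Lambda}$ indecomposable $A$-modules, and put $\Theta=\bigoplus_\lambda\Theta_\lambda$, $Q=\bigoplus_\lambda Q_\lambda$. Let $\mathcal F(\Theta)$ be the class of modules $M$ having a chain $0=M_0\subseteq\dots\subseteq M_n=M$ of submodules with every factor $M_i/M_{i-1}$ isomorphic to some $\Theta_\lambda$. The pair $(\underline\Theta,\underline Q)$ is an *Ext-projective stratifying system* (EPSS) if (1) $\operatorname{Hom}_A(\Theta_\lambda,\Theta_\mu)=0$ whenever $\lambda\nleqslant\mu$; (2) for each $\lambda$ there is an exact sequence $0\to K_\lambda\to Q_\lambda\to\Theta_\lambda\to0$ where $K_\lambda$ has a filtration with factors $\Theta_\mu$, $\mu>\lambda$; (3) $\operatorname{Ext}^1_A(Q_\lambda,M)=0$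 for all $\lambda$ and all $M\in\mathcal F(\Theta)$. A module $M\in\mathcal F(\Theta)$ is *generated in height $i$* if there is an exact sequence $0\to N\to M\to\bigoplus_{h(\lambda)=i}\Theta_\lambda^{\oplus m_\lambda}\to0$ such that $N$ has a filtration with factors $\Theta_\mu$, $h(\mu)>i$, and $M/\operatorname{rad}M$ is isomorphic to the top of $\bigoplus_{h(\lambda)=i}\Theta_\lambda^{\oplus m_\lambda}$ (the zero module is generated in every height). A *relative projective cover* of $M$ is a right minimal surjection $P\to M$ with $P\in\operatorname{add}(Q)$ and kernel in $\mathcal F(\Theta)$; its kernel is the *relative syzygy* $\Omega_\Theta(M)$. The module $M\in\mathcal F(\Theta)$ is *linearly filtered* if there is an $i$ such that $\Omega_\Theta^s(M)$ is generated in height $i+s$ for all $s\geqslant0$. Let $\Gamma=\operatorname{Ext}^*_A(\Theta,\Theta)=\bigoplus_{i\ge0}\operatorname{Ext}^i_A(\Theta,\Theta)$ be the graded algebra with the Yoneda product (composition from right to left), which acts from the left on $\operatorname{Ext}^*_A(M,\Theta)$. A graded left module $N$ over a graded ring $R=\bigoplus_{i\ge0}R_i$ has a *linear projective resolution* if there is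 an exact sequence $\cdots\to P^1\to P^0\to N\to0$ of graded modules and degree-preserving maps in which each $P^s$ is finitely generated projective and is generated in degree $s$. A graded $k$-algebra $R$ is *generalized Koszul* if each $R_i$ is finite-dimensional over $k$ and $R_0$, regarded as an $R$-module via $R\to R_0$ and placed in degree $0$, has a linear projective resolution. **Theorem.** Let $(\underline\Theta,\underline Q)$ be an EPSS indexed by $(\Lambda,\leqslant)$ such that every $\Theta_\lambda$ has a simple top $S_\lambda$, with $S_\lambda\not\cong S_\mu$ for $\lambda\neq\mu$. Assume that $\operatorname{Ext}^i_A(Q,\Theta)=0$ for all $i\geqslant1$, that $\operatorname{Hom}_A(Q,\Theta)\cong\operatorname{Hom}_A(\Theta,\Theta)$ as left $\operatorname{End}_A(\Theta)$-modules, and that every $\Theta_\lambda$ is linearly filtered. Then for every linearly filtered $M\in\mathcal F(\Theta)$ the graded $\Gamma$-module $\operatorname{Ext}^*_A(M,\Theta)$ has a linear projective resolution. In particular, $\Gamma=\operatorname{Ext}^*_A(\Theta,\Theta)$ is a generalized Koszul algebra. -/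

import Mathlib

open CategoryTheory CategoryTheory.Abelian CategoryTheory.Limits

universe v u w

noncomputable section

/-! ### The Yoneda algebra of an object and its graded modules

For `A`-modules `M` and `X`, the direct sum `⨁ i, Ext M X i` is a graded left module over the
graded algebra `⨁ i, Ext X X i`.  Morphisms are composed from right to left: the product
`γ * δ` is "first `δ`, then `γ`", and `γ • x` is "first `x`, then `γ`".  (`Ext.comp` is written
in diagrammatic order.) -/

namespace YonedaExt

theorem isInternal_of_mem_iff {B : ℕ → Type u} [∀ i, AddCommGroup (B i)] {σ : Type*}
    [SetLike σ (DirectSum ℕ B)] [AddSubmonoidClass σ (DirectSum ℕ B)] (S : ℕ → σ)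
    (hS : ∀ i x, x ∈ S i ↔ ∃ b, DirectSum.of B i b = x) : DirectSum.IsInternal S := by
  let f (i : ℕ) : B i →+ S i :=
    { toFun := fun b => ⟨DirectSum.of B i b, (hS _ _).2 ⟨b, rfl⟩⟩
      map_zero' := Subtype.ext (map_zero _)
      map_add' := fun _ _ => Subtype.ext (map_add _ _ _) }
  refine Function.bijective_iff_has_inverse.2 ⟨DirectSum.map f, fun x => ?_, fun x => ?_⟩
  · induction x using DirectSum.induction_on with
    | zero => rw [map_zero, map_zero]
    | of i x =>
      obtain ⟨x, hx⟩ := x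
      obtain ⟨b, rfl⟩ := (hS _ _).1 hx
      rw [DirectSum.coeAddMonoidHom_of]
      exact DirectSum.map_of _ _ _
    | add x y hx hy => rw [map_add, map_add, hx, hy]
  · induction x using DirectSum.induction_on with
    | zero => rw [map_zero, map_zero]
    | of i x => rw [DirectSum.map_of, DirectSum.coeAddMonoidHom_of]; rfl
    | add x y hx hy => rw [map_add, map_add, hx, hy]

variable {A : Type u} [Ring A]

theorem mk_comp_eq {X Y Z : ModuleCat.{u} A} {a b c c' : ℕ} (x : Ext X Y a) (y : Ext Y Z b)
    (h : a + b = c) (h' : a + b = c') :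
    (⟨c, x.comp y h⟩ : Σ n, Ext X Z n) = ⟨c', x.comp y h'⟩ := by
  subst h; subst h'; rfl

theorem mk_comp_id {X Y : ModuleCat.{u} A} {i c : ℕ} (x : Ext X Y i) (h : i + 0 = c) :
    (⟨c, x.comp (Ext.mk₀ (𝟙 Y)) h⟩ : Σ n, Ext X Y n) = ⟨i, x⟩ := by
  rw [mk_comp_eq x (Ext.mk₀ (𝟙 Y)) h (add_zero i), Ext.comp_mk₀_id]

theorem mk_id_comp {X Y : ModuleCat.{u} A} {i c : ℕ} (x : Ext X Y i) (h : 0 + i = c) :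
    (⟨c, (Ext.mk₀ (𝟙 X)).comp x h⟩ : Σ n, Ext X Y n) = ⟨i, x⟩ := by
  rw [mk_comp_eq (Ext.mk₀ (𝟙 X)) x h (zero_add i), Ext.mk₀_id_comp]

theorem mk_comp_assoc {W X Y Z : ModuleCat.{u} A} {i j l : ℕ}
    (x : Ext Y Z i) (y : Ext X Y j) (z : Ext W X l) :
    (⟨i + j + l, z.comp (y.comp x (add_comm j i)) (add_comm l (i + j))⟩ : Σ n, Ext W Z n) =
      ⟨i + (j + l), (z.comp y (add_comm l j)).comp x (add_comm (j + l) i)⟩ := by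
  rw [mk_comp_eq (z.comp y (add_comm l j)) x _ (by omega : j + l + i = i + j + l),
    Ext.comp_assoc z y x (add_comm l j) (add_comm j i) (by omega)]

instance gOne (X : ModuleCat.{u} A) : GradedMonoid.GOne (Ext X X) where
  one := Ext.mk₀ (𝟙 X)

instance gMul (X : ModuleCat.{u} A) : GradedMonoid.GMul (Ext X X) where
  mul {i j} γ δ := δ.comp γ (add_comm j i)

instance gMonoid (X : ModuleCat.{u} A) : GradedMonoid.GMonoid (Ext X X) where
  one_mul := by
    rintro ⟨i, x⟩
    exact mk_comp_id x _
  mul_one := by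
    rintro ⟨i, x⟩
    exact mk_id_comp x _
  mul_assoc := by
    rintro ⟨i, x⟩ ⟨j, y⟩ ⟨l, z⟩
    exact mk_comp_assoc x y z

/-- The Yoneda product on the self-extensions of `X`. -/
instance gRing (X : ModuleCat.{u} A) : DirectSum.GRing (Ext X X) where
  __ := gMonoid X
  mul_zero γ := Ext.zero_comp _ _ γ _ _
  zero_mul δ := Ext.comp_zero δ _ _ _ _
  mul_add γ δ δ' := Ext.add_comp δ δ' γ _
  add_mul γ γ' δ := Ext.comp_add δ γ γ' _
  natCast n := n • Ext.mk₀ (𝟙 X)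
  natCast_zero := zero_smul _ _
  natCast_succ _ := succ_nsmul _ _
  intCast n := n • Ext.mk₀ (𝟙 X)
  intCast_ofNat _ := natCast_zsmul _ _
  intCast_negSucc_ofNat _ := negSucc_zsmul _ _

/-- The self-extensions of `X` act on the extensions of `M` by `X`. -/
instance gSMul (M X : ModuleCat.{u} A) : GradedMonoid.GSMul (Ext X X) (Ext M X) where
  smul {i j} γ x := x.comp γ (add_comm j i)

instance gmodule (M X : ModuleCat.{u} A) : DirectSum.Gmodule (Ext X X) (Ext M X) where
  __ := gSMul M X
  one_smul := by
    rintro ⟨i, x⟩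
    exact mk_comp_id x _
  mul_smul := by
    rintro ⟨i, x⟩ ⟨j, y⟩ ⟨l, z⟩
    exact mk_comp_assoc x y z
  smul_zero γ := Ext.zero_comp _ _ γ _ _
  zero_smul x := Ext.comp_zero x _ _ _ _
  smul_add γ x x' := Ext.add_comp x x' γ _
  add_smul γ γ' x := Ext.comp_add x γ γ' _

variable (k : Type v) [Field k] [Algebra k A]

instance gAlgebra (X : ModuleCat.{u} A) : DirectSum.GAlgebra k (Ext X X) where
  toFun :=
    { toFun := fun r => r • Ext.mk₀ (𝟙 X)
      map_zero' := zero_smul _ _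
      map_add' := fun r s => add_smul r s _ }
  map_one := one_smul _ _
  map_mul r s := by
    refine Eq.trans ?_ (mk_comp_eq (s • Ext.mk₀ (𝟙 X)) (r • Ext.mk₀ (𝟙 X)) (add_zero 0) _)
    rw [Ext.comp_smul, Ext.comp_mk₀_id, ← mul_smul]
    rfl
  commutes r := by
    rintro ⟨i, x⟩
    refine (mk_comp_eq x (r • Ext.mk₀ (𝟙 X)) _ (add_zero i)).trans
      (Eq.trans ?_ (mk_comp_eq (r • Ext.mk₀ (𝟙 X)) x (zero_add i) _))
    rw [Ext.comp_smul, Ext.comp_mk₀_id, Ext.smul_comp, Ext.mk₀_id_comp]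
  smul_def r := by
    rintro ⟨i, x⟩
    refine Eq.trans ?_ (mk_comp_eq x (r • Ext.mk₀ (𝟙 X)) (add_zero i) _)
    rw [Ext.comp_smul, Ext.comp_mk₀_id]
    rfl

/-- The algebra `Ext^*(X, X)`. -/
abbrev ExtAlg (X : ModuleCat.{u} A) : Type u := DirectSum ℕ (Ext X X)

/-- The left `Ext^*(X, X)`-module `Ext^*(M, X)`. -/
abbrev ExtMod (M X : ModuleCat.{u} A) : Type u := DirectSum ℕ (Ext M X)


/-- The degree `i` part of `Ext^*(X, X)`. -/
def algPart (X : ModuleCat.{u} A) (i : ℕ) : Submodule k (ExtAlg X) :=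
  LinearMap.range (DirectSum.lof k ℕ (Ext X X) i)

/-- The degree `i` part of `Ext^*(M, X)`. -/
def modPart (M X : ModuleCat.{u} A) (i : ℕ) : AddSubgroup (ExtMod M X) :=
  (DirectSum.of (Ext M X) i).range

instance algPart_gradedMonoid (X : ModuleCat.{u} A) : SetLike.GradedMonoid (algPart k X) where
  one_mem := ⟨_, rfl⟩
  mul_mem := by
    rintro i j _ _ ⟨x, rfl⟩ ⟨y, rfl⟩
    exact ⟨_, (DirectSum.of_mul_of x y).symm⟩

instance modPart_gradedSMul (M X : ModuleCat.{u} A) :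
    SetLike.GradedSMul (algPart k X) (modPart M X) where
  smul_mem := by
    rintro i j _ _ ⟨x, rfl⟩ ⟨y, rfl⟩
    exact ⟨_, (DirectSum.Gmodule.of_smul_of _ _ x y).symm⟩

instance algPart_gradedAlgebra (X : ModuleCat.{u} A) : GradedAlgebra (algPart k X) where
  __ := (isInternal_of_mem_iff (algPart k X) fun _ _ => Iff.rfl).chooseDecomposition

theorem modPart_isInternal (M X : ModuleCat.{u} A) : DirectSum.IsInternal (modPart M X) :=
  isInternal_of_mem_iff (modPart M X) fun _ _ => Iff.rfl

end YonedaExt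

/-! ### Linear graded modules and generalized Koszul algebras -/

section Linear

variable {R : Type u} [Ring R]

/-- `N` is a left module over the ring `R`, graded by `𝒩`, where `R` is graded by `𝒜`.
The graded module `N` has a resolution `⋯ ⟶ P 1 ⟶ P 0 ⟶ N ⟶ 0` by finitely generated projective
graded modules, with homogeneous maps of degree zero, such that `P s` is generated in degree `s`
for all `s`. -/
def HasLinearProjectiveResolution {σ : Type*} [SetLike σ R] (𝒜 : ℕ → σ)
    {N : Type*} [AddCommGroup N] [Module R N] (𝒩 : ℕ → AddSubgroup N) : Prop :=
  ∃ (P : ℕ → Type u) (_ : ∀ s, AddCommGroup (P s)) (_ : ∀ s, Module R (P s))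
    (G : ∀ s, ℕ → AddSubgroup (P s)) (d : ∀ s, P (s + 1) →ₗ[R] P s) (ε : P 0 →ₗ[R] N),
    -- each `P s` is a finitely generated projective graded module generated in degree `s`
    (∀ s, DirectSum.IsInternal (G s) ∧ SetLike.GradedSMul 𝒜 (G s) ∧
      Module.Finite R (P s) ∧ Module.Projective R (P s) ∧
      Submodule.span R (G s s : Set (P s)) = ⊤) ∧
    -- the maps preserve degrees
    (∀ s i, ∀ x ∈ G (s + 1) i, d s x ∈ G s i) ∧ (∀ i, ∀ x ∈ G 0 i, ε x ∈ 𝒩 i) ∧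
    -- the sequence is exact
    Function.Surjective ε ∧ Function.Exact (d 0) ε ∧ ∀ s, Function.Exact (d (s + 1)) (d s)

/-- A positively graded `k`-algebra `R` is generalized Koszul if it is locally finite, and `R₀`,
which is an `R`-module through the projection `R → R₀` and is concentrated in degree zero, has a
linear projective resolution. -/
def IsGeneralizedKoszul (k : Type v) [Field k] [Algebra k R] (𝒜 : ℕ → Submodule k R)
    [GradedAlgebra 𝒜] : Prop :=
  (∀ i, Module.Finite k (𝒜 i)) ∧
    letI : Module R (𝒜 0) := Module.compHom (𝒜 0) (GradedRing.projZeroRingHom' 𝒜)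
    HasLinearProjectiveResolution 𝒜 (fun i => if i = 0 then (⊤ : AddSubgroup (𝒜 0)) else ⊥)

end Linear

/-! ### Ext-projective stratifying systems -/

namespace StratSystem

variable {A : Type u} [Ring A] {Λ : Type w} [PartialOrder Λ] [Fintype Λ]

/-- `M` has a chain of submodules `0 = F 0 ⊆ F 1 ⊆ ⋯ ⊆ F n = M` such that every factor
`F (i + 1) / F i` is isomorphic to some `Θ l` with `l ∈ S`. -/
def HasFiltration (Θ : Λ → ModuleCat.{u} A) (S : Set Λ) (M : ModuleCat.{u} A) : Prop :=
  ∃ (n : ℕ) (F : ℕ → Submodule A M), Monotone F ∧ F 0 = ⊥ ∧ F n = ⊤ ∧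
    ∀ i < n, ∃ l ∈ S, Nonempty ((F (i + 1) ⧸ (F i).submoduleOf (F (i + 1))) ≃ₗ[A] Θ l)

/-- The category `F(Θ)` of modules filtered by the `Θ l`. -/
abbrev InF (Θ : Λ → ModuleCat.{u} A) (M : ModuleCat.{u} A) : Prop :=
  HasFiltration Θ Set.univ M

/-- `(Θ, Q)` is an Ext-projective stratifying system (EPSS) of finitely generated modules,
indexed by the finite poset `Λ`. -/
structure IsEPSS (Θ Q : Λ → ModuleCat.{u} A) : Prop where
  finite_theta (l : Λ) : Module.Finite A (Θ l)
  nontrivial_theta (l : Λ) : Nontrivial (Θ l)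
  finite_q (l : Λ) : Module.Finite A (Q l)
  indecomposable_q (l : Λ) : Indecomposable (Q l)
  hom_eq_zero (l m : Λ) (h : ¬ l ≤ m) (f : Θ l ⟶ Θ m) : f = 0
  exists_sequence (l : Λ) : ∃ p : Q l ⟶ Θ l, Function.Surjective p.hom ∧
    HasFiltration Θ {m | l < m} (ModuleCat.of A (LinearMap.ker p.hom))
  ext_one_eq_zero (M : ModuleCat.{u} A) (hM : InF Θ M) (l : Λ) (x : Ext (Q l) M 1) : x = 0

/-- The top `M / rad M` of a module. -/
abbrev TopOf (A : Type u) [Ring A] (M : Type v) [AddCommGroup M] [Module A M] : Type v :=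
  M ⧸ Module.jacobson A M

/-- Every `Θ l` has a simple top, and these simple modules are pairwise non-isomorphic. -/
structure HasDistinctSimpleTops (Θ : Λ → ModuleCat.{u} A) : Prop where
  isSimple (l : Λ) : IsSimpleModule A (TopOf A (Θ l))
  eq_of_iso (l m : Λ) (e : Nonempty (TopOf A (Θ l) ≃ₗ[A] TopOf A (Θ m))) : l = m

/-- The height function of the finite poset `Λ`: minimal elements have height `1`, the minimal
elements among the remaining ones have height `2`, and so on.  (`Order.height` starts at `0`.) -/
def ht (l : Λ) : ℕ := (Order.height l).toNat + 1

/-- The direct sum of the modules `Θ l ^ m l` over all `l` of height `i`. -/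
abbrev LayerSum (Θ : Λ → ModuleCat.{u} A) (i : ℕ) (m : Λ → ℕ) :
    Type (max u w) :=
  ∀ l : {l : Λ // ht l = i}, Fin (m l) → Θ l

/-- `M` is generated in height `i`: there is an exact sequence
`0 → N → M → ⨁_{ht l = i} Θ l ^ m l → 0` in which `N` is filtered by modules `Θ l` of height
greater than `i`, and the top of `M` is isomorphic to the top of the direct sum.
The zero module is generated in every height. -/
def GeneratedInHeight (Θ : Λ → ModuleCat.{u} A) (i : ℕ) (M : ModuleCat.{u} A) : Prop :=
  ∃ (N : Submodule A M) (m : Λ → ℕ), HasFiltration Θ {l | i < ht l} (ModuleCat.of A N) ∧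
    Nonempty ((M ⧸ N) ≃ₗ[A] LayerSum Θ i m) ∧
    Nonempty (TopOf A M ≃ₗ[A] TopOf A (LayerSum Θ i m))

/-- `P` belongs to `add Q`: it is a direct summand of a finite direct sum of copies of
`⨁ l, Q l`. -/
def InAdd (Q : Λ → ModuleCat.{u} A) (P : ModuleCat.{u} A) : Prop :=
  ∃ n : ℕ, Nonempty (Retract P (biproduct fun _ : Fin n => biproduct Q))

/-- `p : P ⟶ M` is a relative projective cover of `M`: it is a surjection from an object of
`add Q` with kernel in `F(Θ)`, and it is right minimal. -/
structure IsRelProjCover (Θ Q : Λ → ModuleCat.{u} A) {P M : ModuleCat.{u} A} (p : P ⟶ M) :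
    Prop where
  inAdd : InAdd Q P
  surjective : Function.Surjective p.hom
  ker_inF : InF Θ (ModuleCat.of A (LinearMap.ker p.hom))
  minimal (g : P ⟶ P) (hg : g ≫ p = p) : IsIso g

/-- `K` is the relative syzygy of `M`, i.e. the kernel of a relative projective cover. -/
def IsRelSyzygy (Θ Q : Λ → ModuleCat.{u} A) (M K : ModuleCat.{u} A) : Prop :=
  ∃ (P : ModuleCat.{u} A) (p : P ⟶ M), IsRelProjCover Θ Q p ∧
    Nonempty (K ≅ ModuleCat.of A (LinearMap.ker p.hom))

/-- `M ∈ F(Θ)` is linearly filtered: for some `i`, the `s`-th relative syzygy `Z s` of `M` is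
generated in height `i + s` for all `s`. -/
def IsLinearlyFiltered (Θ Q : Λ → ModuleCat.{u} A) (M : ModuleCat.{u} A) : Prop :=
  InF Θ M ∧ ∃ (i : ℕ) (Z : ℕ → ModuleCat.{u} A), Nonempty (Z 0 ≅ M) ∧
    (∀ s, IsRelSyzygy Θ Q (Z s) (Z (s + 1))) ∧ ∀ s, GeneratedInHeight Θ (i + s) (Z s)

end StratSystem

end

/-! Write `T = ⨁ Θ` and `Γ = Ext^*(T, T)`. The argument turns on one property, `LinearlyLayered`:
`M` has a finite filtration with layers in add `Θ`, and every term `M'` of it, with top layer `L`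
and next term `N`, has `Ext^*(L, T) → Ext^*(M', T)` surjective. The long exact sequence then breaks
up into `0 → Ext^{*-1}(N, T) → Ext^*(L, T) → Ext^*(M', T) → 0`. Since `L` lies in add `Θ`, the
module `Ext^*(L, T)` is finitely generated projective over `Γ` and generated in degree zero.
Splicing these sequences, with a shift by `s` at stage `s`, gives the linear resolution
(`hasLinearProjectiveResolution`).

Linearly filtered modules have this property by descending induction on the height
(`IsGoodSystem.linearlyLayered`). Let `0 → X → P → M → 0` be the relative projective cover and `0 →
N → M → L → 0` the top layer, with `L` a sum of `Θ l` of height `i`. Because `N` lies in the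
radical, the tops are distinct and simple, and `P → M` is right minimal, `P → L` is also the sum of
the covers of these `Θ l`. If `Y` is the sum of their syzygies, there results `0 → X → Y → N → 0`.
By induction `X` and `Y` are linearly layered; `HeightDirected.linearlyLayered_cokernel` passes this
on to `N` and shows that `Ext^*(Y, T) → Ext^*(X, T)` is onto. As `Ext^i(P, T) = 0` for positive `i`,
dimension shifting makes `Ext^*(L, T) → Ext^*(M, T)` onto in positive degrees. In degree zero, every
map `P → T` factors through `L`; this comes from `Hom(Q, T) ≅ Hom(T, T)` and a dimension count
(`exists_comp_eq`).

For the Koszul property, let `P` be the sum of the covers of all `Θ l`. Then `Γ₀ ≅ Ext^*(P, T)` as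
`Γ`-modules, and `P` is linearly layered with top layer `T`. -/

noncomputable section

namespace StratSystem

variable {A : Type u} [Ring A] {Λ : Type w}

/-! ### Modules that are direct summands of sums of members of a family -/

/-- The sums of morphisms that factor through some `B l` with `l ∈ S`. -/
def through (B : Λ → ModuleCat.{u} A) (S : Set Λ) (X Y : ModuleCat.{u} A) : AddSubgroup (X ⟶ Y) :=
  AddSubgroup.closure {g | ∃ l ∈ S, ∃ (a : X ⟶ B l) (b : B l ⟶ Y), g = a ≫ b}

/-- `L` is a direct summand of a finite direct sum of modules `B l` with `l ∈ S`. -/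
def AddOf (B : Λ → ModuleCat.{u} A) (S : Set Λ) (L : ModuleCat.{u} A) : Prop :=
  𝟙 L ∈ through B S L L

section through

variable {B : Λ → ModuleCat.{u} A} {S : Set Λ} {W X Y Z : ModuleCat.{u} A}

theorem comp_mem_through {l : Λ} (hl : l ∈ S) (a : X ⟶ B l) (b : B l ⟶ Y) :
    a ≫ b ∈ through B S X Y :=
  AddSubgroup.subset_closure ⟨l, hl, a, b, rfl⟩

theorem through_comp {g : X ⟶ Y} (hg : g ∈ through B S X Y) (h : Y ⟶ Z) :
    g ≫ h ∈ through B S X Z := by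
  induction hg using AddSubgroup.closure_induction with
  | mem g hg =>
    obtain ⟨l, hl, a, b, rfl⟩ := hg
    rw [Category.assoc]
    exact comp_mem_through hl a _
  | zero => rw [zero_comp]; exact zero_mem _
  | add x y _ _ hx hy => rw [Preadditive.add_comp]; exact add_mem hx hy
  | neg x _ hx => rw [Preadditive.neg_comp]; exact neg_mem hx

theorem comp_through (h : W ⟶ X) {g : X ⟶ Y} (hg : g ∈ through B S X Y) :
    h ≫ g ∈ through B S W Y := by
  induction hg using AddSubgroup.closure_induction with
  | mem g hg =>
    obtain ⟨l, hl, a, b, rfl⟩ := hg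
    rw [← Category.assoc]
    exact comp_mem_through hl _ b
  | zero => rw [comp_zero]; exact zero_mem _
  | add x y _ _ hx hy => rw [Preadditive.comp_add]; exact add_mem hx hy
  | neg x _ hx => rw [Preadditive.comp_neg]; exact neg_mem hx

theorem biproduct_total {J : Type*} [Fintype J] (X : J → ModuleCat.{u} A) :
    ∑ j, biproduct.π X j ≫ biproduct.ι X j = 𝟙 (⨁ X) :=
  IsBilimit.total (biproduct.isBilimit X)

theorem AddOf.mono {S' : Set Λ} (h : AddOf B S X) (hS : S ⊆ S') : AddOf B S' X := by
  refine AddSubgroup.closure_mono ?_ h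
  rintro _ ⟨l, hl, r⟩
  exact ⟨l, hS hl, r⟩

theorem AddOf.of_mem {l : Λ} (hl : l ∈ S) : AddOf B S (B l) := by
  have := comp_mem_through hl (𝟙 (B l)) (𝟙 (B l))
  rwa [Category.comp_id] at this

theorem AddOf.of_retract (h : AddOf B S X) (i : Y ⟶ X) (r : X ⟶ Y) (hir : i ≫ r = 𝟙 Y) :
    AddOf B S Y := by
  have := comp_through i (through_comp h r)
  rwa [Category.id_comp, hir] at this

theorem AddOf.of_iso (h : AddOf B S X) (e : X ≅ Y) : AddOf B S Y :=
  h.of_retract e.inv e.hom e.inv_hom_id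

theorem AddOf.of_isZero (h : IsZero X) : AddOf B S X := by
  rw [AddOf, h.eq_of_src (𝟙 X) 0]
  exact zero_mem _

theorem AddOf.biproduct {J : Type*} [Finite J] (X : J → ModuleCat.{u} A)
    (h : ∀ j, AddOf B S (X j)) : AddOf B S (⨁ X) := by
  have := Fintype.ofFinite J
  rw [AddOf, ← biproduct_total]
  refine sum_mem fun j _ => ?_
  have := comp_through (biproduct.π X j) (through_comp (h j) (biproduct.ι X j))
  rwa [Category.id_comp] at this

theorem AddOf.biprod (hX : AddOf B S X) (hY : AddOf B S Y) : AddOf B S (X ⊞ Y) := by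
  rw [AddOf, ← biprod.total]
  have h₁ := comp_through (biprod.fst : X ⊞ Y ⟶ X) (through_comp hX (biprod.inl : X ⟶ X ⊞ Y))
  have h₂ := comp_through (biprod.snd : X ⊞ Y ⟶ Y) (through_comp hY (biprod.inr : Y ⟶ X ⊞ Y))
  rw [Category.id_comp] at h₁ h₂
  exact add_mem h₁ h₂

/-- Composition with `g` kills `x` when `g` factors through some `B l`, hence on the subgroup
generated by such `g`, which contains the identity of `Y`. -/
theorem AddOf.ext_eq_zero (h : AddOf B S Y) {n : ℕ} (h0 : ∀ l ∈ S, ∀ x : Ext X (B l) n, x = 0)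
    (x : Ext X Y n) : x = 0 := by
  have key : ∀ g ∈ through B S Y Y, x.comp (Ext.mk₀ g) (add_zero n) = 0 := by
    intro g hg
    induction hg using AddSubgroup.closure_induction with
    | mem g hg =>
      obtain ⟨l, hl, a, b, rfl⟩ := hg
      rw [← Ext.mk₀_comp_mk₀, ← Ext.comp_assoc_of_third_deg_zero,
        h0 l hl (x.comp (Ext.mk₀ a) (add_zero n)), Ext.zero_comp]
    | zero => rw [Ext.mk₀_zero, Ext.comp_zero]
    | add x y _ _ hx hy => rw [Ext.mk₀_add, Ext.comp_add, hx, hy, add_zero]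
    | neg x _ hx => rw [Ext.mk₀_neg, Ext.comp_neg, hx, neg_zero]
  rw [← Ext.comp_mk₀_id x, key _ h]

theorem AddOf.ext_eq_zero' (h : AddOf B S X) {n : ℕ} (h0 : ∀ l ∈ S, ∀ x : Ext (B l) Y n, x = 0)
    (x : Ext X Y n) : x = 0 := by
  have key : ∀ g ∈ through B S X X, (Ext.mk₀ g).comp x (zero_add n) = 0 := by
    intro g hg
    induction hg using AddSubgroup.closure_induction with
    | mem g hg =>
      obtain ⟨l, hl, a, b, rfl⟩ := hg
      rw [← Ext.mk₀_comp_mk₀_assoc,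
        h0 l hl ((Ext.mk₀ b).comp x (zero_add n)), Ext.comp_zero]
    | zero => rw [Ext.mk₀_zero, Ext.zero_comp]
    | add x y _ _ hx hy => rw [Ext.mk₀_add, Ext.add_comp, hx, hy, add_zero]
    | neg x _ hx => rw [Ext.mk₀_neg, Ext.neg_comp, hx, neg_zero]
  rw [← Ext.mk₀_id_comp x, key _ h]

theorem AddOf.hom_eq_zero (h : AddOf B S Y) (h0 : ∀ l ∈ S, ∀ x : X ⟶ B l, x = 0)
    (x : X ⟶ Y) : x = 0 := by
  rw [← Ext.mk₀_eq_zero_iff]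
  refine h.ext_eq_zero (fun l hl y => ?_) _
  obtain ⟨f, rfl⟩ := (Ext.mk₀_bijective _ _).2 y
  rw [h0 l hl f, Ext.mk₀_zero]

theorem AddOf.hom_eq_zero' (h : AddOf B S X) (h0 : ∀ l ∈ S, ∀ x : B l ⟶ Y, x = 0)
    (x : X ⟶ Y) : x = 0 := by
  rw [← Ext.mk₀_eq_zero_iff]
  refine h.ext_eq_zero' (fun l hl y => ?_) _
  obtain ⟨f, rfl⟩ := (Ext.mk₀_bijective _ _).2 y
  rw [h0 l hl f, Ext.mk₀_zero]

theorem InAdd.addOf [Fintype Λ] (h : InAdd B X) : AddOf B Set.univ X := by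
  obtain ⟨n, ⟨r⟩⟩ := h
  exact AddOf.of_retract (AddOf.biproduct _ fun _ => AddOf.biproduct _ fun l =>
    AddOf.of_mem (Set.mem_univ l)) r.i r.r r.retract

end through

/-! ### Short exact sequences -/

section exact

variable {N M L X Y Z : ModuleCat.{u} A} {f : N ⟶ M} {g : M ⟶ L} {w : f ≫ g = 0}

theorem shortExact_of_apply (hf : Function.Injective f) (hg : Function.Surjective g)
    (h : ∀ x, g x = 0 → ∃ y, f y = x) : (ShortComplex.mk f g w).ShortExact where
  exact := (ShortComplex.moduleCat_exact_iff _).2 h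
  mono_f := (ModuleCat.mono_iff_injective _).2 hf
  epi_g := (ModuleCat.epi_iff_surjective _).2 hg

theorem exists_shortExact (g : M ⟶ L) (hg : Function.Surjective g) :
    ∃ w, (ShortComplex.mk (ModuleCat.ofHom (LinearMap.ker g.hom).subtype) g w).ShortExact :=
  ⟨by ext x; exact x.2, shortExact_of_apply Subtype.val_injective hg fun x hx => ⟨⟨x, hx⟩, rfl⟩⟩

variable (S : (ShortComplex.mk f g w).ShortExact)
include S

theorem exact_inj : Function.Injective f := S.moduleCat_injective_f

theorem exact_surj : Function.Surjective g := S.moduleCat_surjective_g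

theorem exact_exists {x : M} (h : g x = 0) : ∃ y, f y = x :=
  (ShortComplex.moduleCat_exact_iff _).1 S.exact x h

theorem exact_epi : Epi g := S.epi_g

theorem exact_mono : Mono f := S.mono_f

theorem exact_isIso_g (h : IsZero N) : IsIso g := by
  have := S.epi_g
  have := (S.exact.mono_g_iff).2 (h.eq_of_src _ _)
  exact isIso_of_mono_of_epi (C := ModuleCat.{u} A) g

theorem isZero_of_exact (hN : IsZero N) (hL : IsZero L) : IsZero M := by
  have := exact_isIso_g S hN
  exact hL.of_iso (asIso g)

/-- A morphism that vanishes on the kernel descends to the cokernel. -/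
theorem exact_desc (h : M ⟶ X) (hh : f ≫ h = 0) : ∃ k : L ⟶ X, g ≫ k = h := by
  have := S.epi_g
  exact ⟨S.exact.desc h hh, S.exact.g_desc h hh⟩

theorem exact_lift (h : X ⟶ M) (hh : h ≫ g = 0) : ∃ k : X ⟶ N, k ≫ f = h := by
  have := S.mono_f
  exact ⟨S.exact.lift h hh, S.exact.lift_f h hh⟩

/-- A morphism to the cokernel lifts if an extension group vanishes. -/
theorem exact_lift_of_ext (h0 : ∀ x : Ext X N 1, x = 0) (h : X ⟶ L) :
    ∃ k : X ⟶ M, k ≫ g = h := by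
  obtain ⟨x, hx⟩ := Ext.covariant_sequence_exact₃ X S (Ext.mk₀ h) (zero_add 1) (h0 _)
  obtain ⟨k, rfl⟩ := (Ext.mk₀_bijective _ _).2 x
  refine ⟨k, (Ext.mk₀_bijective _ _).1 ?_⟩
  rw [← hx, Ext.mk₀_comp_mk₀]

/-- A morphism from the kernel extends if an extension group vanishes. -/
theorem exact_extend_of_ext (h0 : ∀ x : Ext L X 1, x = 0) (h : N ⟶ X) :
    ∃ k : M ⟶ X, f ≫ k = h := by
  obtain ⟨x, hx⟩ := Ext.contravariant_sequence_exact₁ S X (Ext.mk₀ h) (add_zero 1) (h0 _)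
  obtain ⟨k, rfl⟩ := (Ext.mk₀_bijective _ _).2 x
  refine ⟨k, (Ext.mk₀_bijective _ _).1 ?_⟩
  rw [← hx, Ext.mk₀_comp_mk₀]

theorem exact_ext_eq_zero {n : ℕ} (hN : ∀ x : Ext X N n, x = 0) (hL : ∀ x : Ext X L n, x = 0)
    (x : Ext X M n) : x = 0 := by
  obtain ⟨y, rfl⟩ := Ext.covariant_sequence_exact₂ X S x (hL _)
  rw [hN y, Ext.zero_comp]

theorem exact_ext_eq_zero' {n : ℕ} (hN : ∀ x : Ext N X n, x = 0) (hL : ∀ x : Ext L X n, x = 0)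
    (x : Ext M X n) : x = 0 := by
  obtain ⟨y, rfl⟩ := Ext.contravariant_sequence_exact₂ S X x (hN _)
  rw [hL y, Ext.comp_zero]

theorem exact_hom_eq_zero' (hN : ∀ x : N ⟶ X, x = 0) (hL : ∀ x : L ⟶ X, x = 0)
    (x : M ⟶ X) : x = 0 := by
  obtain ⟨k, rfl⟩ := exact_desc S x (hN _)
  rw [hL k, comp_zero]

theorem exact_of_iso (e : X ≅ M) :
    ∃ w, (ShortComplex.mk (f ≫ e.inv) (e.hom ≫ g) w).ShortExact :=
  ⟨by simp [w], ShortComplex.shortExact_of_iso (S₁ := ShortComplex.mk f g w)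
    (ShortComplex.isoMk (Iso.refl _) e.symm (Iso.refl _) (by simp) (by simp)) S⟩

omit S in
theorem exact_biproduct {J : Type*} [Finite J] {N M L : J → ModuleCat.{u} A}
    {f : ∀ j, N j ⟶ M j} {g : ∀ j, M j ⟶ L j} {w : ∀ j, f j ≫ g j = 0}
    (S : ∀ j, (ShortComplex.mk (f j) (g j) (w j)).ShortExact) :
    ∃ w, (ShortComplex.mk (biproduct.map f) (biproduct.map g) w).ShortExact := by
  have := fun j => exact_epi (S j)
  have := fun j => exact_mono (S j)
  have := Fintype.ofFinite J
  refine ⟨by ext; simp [w], shortExact_of_apply ((ModuleCat.mono_iff_injective _).1 inferInstance)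
    ((ModuleCat.epi_iff_surjective _).1 inferInstance) fun x hx => ?_⟩
  have h (j : J) : ∃ y, f j y = biproduct.π M j x := by
    refine exact_exists (S j) ?_
    rw [← ConcreteCategory.comp_apply, ← biproduct.map_π, ConcreteCategory.comp_apply, hx, map_zero]
  choose y hy using h
  refine ⟨∑ j, biproduct.ι N j (y j), ?_⟩
  have hx' : x = ∑ j, biproduct.ι M j (biproduct.π M j x) := by
    have := congr($(biproduct_total M) x)
    simpa [ModuleCat.hom_sum] using this.symm
  rw [hx', map_sum]
  refine Finset.sum_congr rfl fun j _ => ?_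
  rw [← hy j, ← ConcreteCategory.comp_apply, biproduct.ι_map, ConcreteCategory.comp_apply]

end exact

end StratSystem

end

/-! ### Heights and modules layered by height -/

namespace StratSystem

variable {A : Type u} [Ring A]

/-- The sequence of kernels in a short exact sequence of short exact sequences. -/
theorem exact_kernels {N₁ M₁ L₁ N₂ M₂ L₂ N₃ M₃ L₃ : ModuleCat.{u} A}
    {f₁ : N₁ ⟶ M₁} {g₁ : M₁ ⟶ L₁} {w₁ : f₁ ≫ g₁ = 0} (S₁ : (ShortComplex.mk f₁ g₁ w₁).ShortExact)
    {f₂ : N₂ ⟶ M₂} {g₂ : M₂ ⟶ L₂} {w₂ : f₂ ≫ g₂ = 0} (S₂ : (ShortComplex.mk f₂ g₂ w₂).ShortExact)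
    {f₃ : N₃ ⟶ M₃} {g₃ : M₃ ⟶ L₃} {w₃ : f₃ ≫ g₃ = 0} (S₃ : (ShortComplex.mk f₃ g₃ w₃).ShortExact)
    {φM : M₁ ⟶ M₂} {ψM : M₂ ⟶ M₃} {wM : φM ≫ ψM = 0} (SM : (ShortComplex.mk φM ψM wM).ShortExact)
    {φL : L₁ ⟶ L₂} {ψL : L₂ ⟶ L₃} {wL : φL ≫ ψL = 0} (SL : (ShortComplex.mk φL ψL wL).ShortExact)
    {φN : N₁ ⟶ N₂} {ψN : N₂ ⟶ N₃} (hφN : f₁ ≫ φM = φN ≫ f₂) (hψN : f₂ ≫ ψM = ψN ≫ f₃)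
    (hφ : g₁ ≫ φL = φM ≫ g₂) (hψ : g₂ ≫ ψL = ψM ≫ g₃) :
    ∃ wN, (ShortComplex.mk φN ψN wN).ShortExact := by
  have hφN' (x) : φM (f₁ x) = f₂ (φN x) := congr($hφN x)
  have hψN' (x) : ψM (f₂ x) = f₃ (ψN x) := congr($hψN x)
  have hφ' (x) : φL (g₁ x) = g₂ (φM x) := congr($hφ x)
  have hψ' (x) : ψL (g₂ x) = g₃ (ψM x) := congr($hψ x)
  have hw₁ (x) : g₁ (f₁ x) = 0 := congr($w₁ x)
  have hw₂ (x) : g₂ (f₂ x) = 0 := congr($w₂ x)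
  have := exact_mono S₃
  refine ⟨?_, shortExact_of_apply (fun x y hxy => exact_inj S₁ (exact_inj SM ?_)) (fun z => ?_)
    fun y hy => ?_⟩
  · rw [← cancel_mono f₃, Category.assoc, ← hψN, ← Category.assoc, ← hφN, Category.assoc, wM,
      comp_zero, zero_comp]
  · rw [hφN', hφN', hxy]
  -- A preimage of `f₃ z` in `M₂` is corrected by an element of `M₁` so that it comes from `N₂`.
  · obtain ⟨y, hy⟩ := exact_surj SM (f₃ z)
    have h0 : ψL (g₂ y) = 0 := by
      rw [hψ']
      exact (congrArg g₃ hy).trans congr($w₃ z)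
    obtain ⟨l, hl⟩ := exact_exists SL h0
    obtain ⟨x, rfl⟩ := exact_surj S₁ l
    have h1 : g₂ (y - φM x) = 0 := by rw [map_sub, ← hφ', hl, sub_self]
    obtain ⟨y', hy'⟩ := exact_exists S₂ h1
    refine ⟨y', exact_inj S₃ ?_⟩
    rw [← hψN', hy', map_sub, hy, sub_eq_self]
    exact congr($wM x)
  · have h0 : ψM (f₂ y) = 0 := by rw [hψN', hy, map_zero]
    obtain ⟨x, hx⟩ := exact_exists SM h0
    have h1 : g₁ x = 0 := by
      apply exact_inj SL
      rw [hφ', hx, hw₂, map_zero]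
    obtain ⟨x', rfl⟩ := exact_exists S₁ h1
    exact ⟨x', exact_inj S₂ (by rw [← hφN', hx])⟩

variable {Λ : Type w} [PartialOrder Λ]

theorem ht_strictMono [Finite Λ] : StrictMono (ht : Λ → ℕ) := by
  intro l m h
  have := Fintype.ofFinite Λ
  -- Chains in a finite poset are bounded, so `toNat` is never applied to `⊤`.
  have h₁ (a : Λ) : Order.height a ≠ ⊤ := by
    refine ne_top_of_le_ne_top (ENat.natCast_ne_top (Fintype.card Λ))
      (Order.height_le fun p _ => ?_)
    exact_mod_cast p.length_lt_card.le
  have := Order.height_strictMono h (h₁ l).lt_top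
  rw [← ENat.natCast_toNat (h₁ l), ← ENat.natCast_toNat (h₁ m), Nat.cast_lt] at this
  exact Nat.succ_lt_succ this

/-- There are no morphisms to members of smaller height, and no extensions by members of
smaller or equal height. -/
structure HeightDirected (Θ : Λ → ModuleCat.{u} A) : Prop where
  hom_eq_zero (l m : Λ) (h : ht m < ht l) (f : Θ l ⟶ Θ m) : f = 0
  ext_eq_zero (l m : Λ) (h : ht m ≤ ht l) (x : Ext (Θ l) (Θ m) 1) : x = 0

/-- `M` has a filtration of length `n` whose `j`-th layer from the top is a direct summand of a
sum of modules `Θ l` of height `i + j`. -/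
def Layered (Θ : Λ → ModuleCat.{u} A) : ℕ → ℕ → ModuleCat.{u} A → Prop
  | 0, _, M => IsZero M
  | n + 1, i, M => ∃ (N L : ModuleCat.{u} A) (f : N ⟶ M) (g : M ⟶ L) (w : f ≫ g = 0),
      (ShortComplex.mk f g w).ShortExact ∧ AddOf Θ {l | ht l = i} L ∧ Layered Θ n (i + 1) N

variable {Θ : Λ → ModuleCat.{u} A}

theorem Layered.of_isZero {M : ModuleCat.{u} A} (h : IsZero M) (n i : ℕ) : Layered Θ n i M := by
  induction n generalizing i with
  | zero => exact h
  | succ n ih =>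
    exact ⟨M, M, 𝟙 M, 0, by simp, shortExact_of_apply (fun _ _ h => h)
      (fun x => ⟨0, by have := ModuleCat.subsingleton_of_isZero h; exact Subsingleton.elim _ _⟩)
      (fun x _ => ⟨x, rfl⟩), AddOf.of_isZero h, ih _⟩

theorem Layered.of_iso {M M' : ModuleCat.{u} A} {n i : ℕ} (h : Layered Θ n i M) (e : M' ≅ M) :
    Layered Θ n i M' := by
  cases n with
  | zero => exact IsZero.of_iso h e
  | succ n =>
    obtain ⟨N, L, f, g, w, S, hL, hN⟩ := h
    obtain ⟨w', S'⟩ := exact_of_iso S e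
    exact ⟨N, L, _, _, w', S', hL, hN⟩

theorem Layered.induction {P : ModuleCat.{u} A → Prop} {n i : ℕ} {M : ModuleCat.{u} A}
    (h : Layered Θ n i M) (zero : ∀ M, IsZero M → P M)
    (add : ∀ j, i ≤ j → ∀ L, AddOf Θ {l | ht l = j} L → P L)
    (ext : ∀ {N M L : ModuleCat.{u} A} (f : N ⟶ M) (g : M ⟶ L) (w : f ≫ g = 0),
      (ShortComplex.mk f g w).ShortExact → P N → P L → P M) : P M := by
  induction n generalizing i M with
  | zero => exact zero M h
  | succ n ih =>
    obtain ⟨N, L, f, g, w, S, hL, hN⟩ := h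
    exact ext f g w S (ih hN fun j hj => add j (by omega)) (add i le_rfl L hL)

theorem isZero_ext_eq_zero {X Y : ModuleCat.{u} A} (h : IsZero Y) {n : ℕ} (x : Ext X Y n) :
    x = 0 := by
  rw [← Ext.comp_mk₀_id x, h.eq_of_src (𝟙 Y) 0, Ext.mk₀_zero, Ext.comp_zero]

theorem isZero_ext_eq_zero' {X Y : ModuleCat.{u} A} (h : IsZero X) {n : ℕ} (x : Ext X Y n) :
    x = 0 := by
  rw [← Ext.mk₀_id_comp x, h.eq_of_src (𝟙 X) 0, Ext.mk₀_zero, Ext.zero_comp]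

theorem Layered.ext_eq_zero_of_forall {X M : ModuleCat.{u} A} {n i t : ℕ} (h : Layered Θ n i M)
    (h0 : ∀ l, ∀ x : Ext X (Θ l) t, x = 0) (x : Ext X M t) : x = 0 := by
  have : ∀ x : Ext X M t, x = 0 := by
    refine h.induction (P := fun M => ∀ x : Ext X M t, x = 0) (fun M hM => isZero_ext_eq_zero hM)
      (fun j _ L hL => hL.ext_eq_zero fun l _ => h0 l) fun f g w S => exact_ext_eq_zero S
  exact this x

namespace HeightDirected

variable (D : HeightDirected Θ) {n i j : ℕ} {M L : ModuleCat.{u} A}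
include D

theorem layered_hom_eq_zero (hM : Layered Θ n i M) (hL : AddOf Θ {l | ht l = j} L) (hj : j < i)
    (x : M ⟶ L) : x = 0 := by
  have : ∀ x : M ⟶ L, x = 0 := by
    refine hM.induction (P := fun M => ∀ x : M ⟶ L, x = 0) (fun M hM x => hM.eq_of_src _ _)
      (fun j' hj' L' hL' => hL'.hom_eq_zero' fun l hl => hL.hom_eq_zero fun m hm =>
        D.hom_eq_zero l m ?_) fun f g w S => exact_hom_eq_zero' S
    simp only [Set.mem_ofPred_eq] at hl hm
    omega
  exact this x

theorem layered_ext_eq_zero (hM : Layered Θ n i M) (hL : AddOf Θ {l | ht l = j} L) (hj : j ≤ i)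
    (x : Ext M L 1) : x = 0 := by
  have : ∀ x : Ext M L 1, x = 0 := by
    refine hM.induction (P := fun M => ∀ x : Ext M L 1, x = 0) (fun M hM => isZero_ext_eq_zero' hM)
      (fun j' hj' L' hL' => hL'.ext_eq_zero' fun l hl => hL.ext_eq_zero fun m hm =>
        D.ext_eq_zero l m ?_) fun f g w S => exact_ext_eq_zero' S
    simp only [Set.mem_ofPred_eq] at hl hm
    omega
  exact this x

/-- A horseshoe argument: `Ext^1(M₂, L₁) = 0` because no height in `M₂` is below that of `L₁`, so
`M₁ ⟶ L₁` extends to `M`. Then `L₁ ⊞ L₂` is a top layer of `M`, and its kernel is an extension of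
`N₂` by `N₁`. -/
theorem layered_of_exact {M₁ M₂ : ModuleCat.{u} A} {f : M₁ ⟶ M} {g : M ⟶ M₂} {w : f ≫ g = 0}
    (S : (ShortComplex.mk f g w).ShortExact) (h₁ : Layered Θ n i M₁) (h₂ : Layered Θ n i M₂) :
    Layered Θ n i M := by
  induction n generalizing i M M₁ M₂ with
  | zero => exact isZero_of_exact S h₁ h₂
  | succ n ih =>
    have h₂' := h₂
    obtain ⟨N₁, L₁, f₁, g₁, w₁, S₁, hL₁, hN₁⟩ := h₁
    obtain ⟨N₂, L₂, f₂, g₂, w₂, S₂, hL₂, hN₂⟩ := h₂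
    obtain ⟨g', hg'⟩ := exact_extend_of_ext S (D.layered_ext_eq_zero h₂' hL₁ le_rfl) g₁
    have hq : Function.Surjective (biprod.lift g' (g ≫ g₂)) := by
      rw [← ModuleCat.epi_iff_surjective]
      have e₁ := exact_epi S₁
      have e₂ := exact_epi S₂
      have e := exact_epi S
      refine Preadditive.epi_of_cancel_zero _ fun {P} q hq => biprod.hom_ext' _ _ ?_ ?_
      · have : f ≫ biprod.lift g' (g ≫ g₂) = g₁ ≫ biprod.inl := by
          apply biprod.hom_ext <;> simp [hg', reassoc_of% w]
        rw [comp_zero, ← cancel_epi g₁, comp_zero, ← Category.assoc, ← this, Category.assoc, hq,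
          comp_zero]
      · have h0 : biprod.inl ≫ q = 0 := by
          have : f ≫ biprod.lift g' (g ≫ g₂) = g₁ ≫ biprod.inl := by
            apply biprod.hom_ext <;> simp [hg', reassoc_of% w]
          rw [← cancel_epi g₁, comp_zero, ← Category.assoc, ← this, Category.assoc, hq,
            comp_zero]
        have : biprod.lift g' (g ≫ g₂) = g' ≫ biprod.inl + (g ≫ g₂) ≫ biprod.inr := by
          apply biprod.hom_ext <;> simp
        rw [this, Preadditive.add_comp, Category.assoc, h0, comp_zero, zero_add] at hq
        rw [comp_zero, ← cancel_epi g₂, comp_zero, ← cancel_epi g, comp_zero]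
        simpa using hq
    obtain ⟨w', S'⟩ := exists_shortExact _ hq
    obtain ⟨a, ha⟩ := exact_lift S' (f₁ ≫ f) (by apply biprod.hom_ext <;> simp [hg', w₁, reassoc_of% w])
    obtain ⟨b, hb⟩ := exact_lift S₂
      (ModuleCat.ofHom (LinearMap.ker (biprod.lift g' (g ≫ g₂)).hom).subtype ≫ g) (by
        have := congr($w' ≫ biprod.snd)
        simpa using this)
    obtain ⟨_, S''⟩ := exact_kernels S₁ S' S₂ S
      (ShortComplex.Splitting.ofHasBinaryBiproduct L₁ L₂).shortExact ha.symm hb.symm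
      (by apply biprod.hom_ext <;> simp [hg', reassoc_of% w]) (by simp)
    exact ⟨_, _, _, _, w', S', hL₁.biprod hL₂ |>.mono (by simp), ih S'' hN₁ hN₂⟩

omit D in
theorem layered_of_mem (l : Λ) (n i : ℕ) (hi : i ≤ ht l) (hn : ht l < i + n) :
    Layered Θ n i (Θ l) := by
  induction n generalizing i with
  | zero => omega
  | succ n ih =>
    by_cases h : ht l = i
    · refine ⟨.of A PUnit, Θ l, 0, 𝟙 _, by simp, shortExact_of_apply
        (fun _ _ _ => Subsingleton.elim _ _) (fun x => ⟨x, rfl⟩) (fun x hx => ⟨0, ?_⟩),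
        AddOf.of_mem h, Layered.of_isZero (ModuleCat.isZero_of_subsingleton _) _ _⟩
      simpa using hx.symm
    · refine ⟨Θ l, .of A PUnit, 𝟙 _, 0, by simp, shortExact_of_apply (fun _ _ h => h)
        (fun x => ⟨0, Subsingleton.elim _ _⟩) (fun x _ => ⟨x, rfl⟩),
        AddOf.of_isZero (ModuleCat.isZero_of_subsingleton _), ih _ (by omega) (by omega)⟩

end HeightDirected

omit [PartialOrder Λ] in
/-- Induction along a filtration by members of a family. -/
theorem HasFiltration.induction {S : Set Λ} {P : ModuleCat.{u} A → Prop} {M : ModuleCat.{u} A}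
    (h : HasFiltration Θ S M) (zero : ∀ M, IsZero M → P M)
    (iso : ∀ {M M' : ModuleCat.{u} A}, (M ≅ M') → P M → P M')
    (step : ∀ {N M L : ModuleCat.{u} A} (f : N ⟶ M) (g : M ⟶ L) (w : f ≫ g = 0),
      (ShortComplex.mk f g w).ShortExact → P N → (∃ l ∈ S, Nonempty (L ≅ Θ l)) → P M) : P M := by
  obtain ⟨n, F, hF, h0, hn, h⟩ := h
  have key : ∀ m ≤ n, P (.of A (F m)) := by
    intro m hm
    induction m with
    | zero =>
      refine zero _ ?_
      rw [h0]
      exact ModuleCat.isZero_of_subsingleton _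
    | succ m ih =>
      obtain ⟨l, hl, ⟨e⟩⟩ := h m (by omega)
      have hm' : F m ≤ F (m + 1) := hF (Nat.le_add_right m 1)
      refine step (ModuleCat.ofHom (Submodule.inclusion hm'))
        (ModuleCat.ofHom ((F m).submoduleOf (F (m + 1))).mkQ) ?_ (shortExact_of_apply
          (Submodule.inclusion_injective hm') (Submodule.mkQ_surjective _) fun x hx => ?_)
        (ih (by omega)) ⟨l, hl, ⟨e.toModuleIso⟩⟩
      · ext x
        exact (Submodule.Quotient.mk_eq_zero _).2 x.2
      · exact ⟨⟨x, (Submodule.Quotient.mk_eq_zero ((F m).submoduleOf (F (m + 1)))).1 hx⟩, rfl⟩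
  have := key n le_rfl
  rw [hn] at this
  exact iso Submodule.topEquiv.toModuleIso this

/-- A single `Θ l` is layered with one nonzero layer, and layered modules are closed under
extensions; thus factors in any order can be sorted by height. -/
theorem HeightDirected.layered_of_hasFiltration (D : HeightDirected Θ) {S : Set Λ} {n i : ℕ}
    (hS : ∀ l ∈ S, i ≤ ht l ∧ ht l < i + n) {M : ModuleCat.{u} A} (h : HasFiltration Θ S M) :
    Layered Θ n i M := by
  refine h.induction (P := Layered Θ n i) (fun M hM => Layered.of_isZero hM n i)
    (fun e hM => hM.of_iso e.symm) fun f g w S hN ⟨l, hl, ⟨e⟩⟩ => D.layered_of_exact S hN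
      ((layered_of_mem l n i (hS l hl).1 (hS l hl).2).of_iso e)

end StratSystem

/-! ### Surjectivity on extensions and linearly layered modules -/

namespace StratSystem

variable {A : Type u} [Ring A]

theorem extClass_naturality_assoc {N₁ M₁ L₁ N₂ M₂ L₂ Y : ModuleCat.{u} A}
    {f₁ : N₁ ⟶ M₁} {g₁ : M₁ ⟶ L₁} {w₁ : f₁ ≫ g₁ = 0} (S₁ : (ShortComplex.mk f₁ g₁ w₁).ShortExact)
    {f₂ : N₂ ⟶ M₂} {g₂ : M₂ ⟶ L₂} {w₂ : f₂ ≫ g₂ = 0} (S₂ : (ShortComplex.mk f₂ g₂ w₂).ShortExact)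
    {a : N₁ ⟶ N₂} {b : M₁ ⟶ M₂} {c : L₁ ⟶ L₂} (hab : a ≫ f₂ = f₁ ≫ b) (hbc : b ≫ g₂ = g₁ ≫ c)
    {n m : ℕ} (γ : Ext N₂ Y n) (h : 1 + n = m) :
    (Ext.mk₀ c).comp (S₂.extClass.comp γ h) (zero_add m) =
      S₁.extClass.comp ((Ext.mk₀ a).comp γ (zero_add n)) h := by
  let φ : ShortComplex.mk f₁ g₁ w₁ ⟶ ShortComplex.mk f₂ g₂ w₂ := ⟨a, b, c, hab, hbc⟩
  have := ShortComplex.ShortExact.extClass_naturality S₁ S₂ φ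
  calc _ = ((Ext.mk₀ c).comp S₂.extClass (zero_add 1)).comp γ h :=
        (Ext.comp_assoc _ _ _ _ _ (by omega)).symm
    _ = (S₁.extClass.comp (Ext.mk₀ a) (add_zero 1)).comp γ h := by rw [← this]
    _ = _ := Ext.comp_assoc _ _ _ _ _ (by omega)

/-- Every extension of `M` by `T` is the restriction of an extension of `L` along `g`. -/
def ExtSurj (T : ModuleCat.{u} A) {M L : ModuleCat.{u} A} (g : M ⟶ L) : Prop :=
  ∀ (t : ℕ) (x : Ext M T t), ∃ y : Ext L T t, (Ext.mk₀ g).comp y (zero_add t) = x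

section

variable {T N M L : ModuleCat.{u} A} {f : N ⟶ M} {g : M ⟶ L} {w : f ≫ g = 0}

theorem ExtSurj.of_comp_eq {g' : N ⟶ L} (h : ExtSurj T g') (k : M ⟶ L) (hk : f ≫ k = g') :
    ExtSurj T f := by
  intro t x
  obtain ⟨y, rfl⟩ := h t x
  exact ⟨(Ext.mk₀ k).comp y (zero_add t), by rw [Ext.mk₀_comp_mk₀_assoc, hk]⟩

theorem ExtSurj.exists_hom {l : ModuleCat.{u} A} (h : ExtSurj T g) (i : l ⟶ T) (r : T ⟶ l)
    (hir : i ≫ r = 𝟙 l) (x : M ⟶ l) : ∃ y, g ≫ y = x := by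
  obtain ⟨y, hy⟩ := h 0 (Ext.mk₀ (x ≫ i))
  obtain ⟨y, rfl⟩ := (Ext.mk₀_bijective _ _).2 y
  rw [Ext.mk₀_comp_mk₀] at hy
  have := (Ext.mk₀_bijective _ _).1 hy
  exact ⟨y ≫ r, by rw [← Category.assoc, this, Category.assoc, hir, Category.comp_id]⟩

/-- Restriction along the quotient map is injective if restriction to the kernel is surjective. -/
theorem ExtSurj.ext_inj (S : (ShortComplex.mk f g w).ShortExact) (h : ExtSurj T f) {t : ℕ}
    (x : Ext L T t) (hx : (Ext.mk₀ g).comp x (zero_add t) = 0) : x = 0 := by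
  have := exact_epi S
  cases t with
  | zero =>
    apply Ext.precomp_mk₀_injective_of_epi T g
    simpa using hx
  | succ t =>
    obtain ⟨y, rfl⟩ := Ext.contravariant_sequence_exact₃ S T x hx (add_comm 1 t)
    obtain ⟨y, rfl⟩ := h t y
    exact S.extClass_comp_assoc y

end

variable {Λ : Type w} [PartialOrder Λ]

/-- `M` has a filtration of length `n` whose `j`-th layer from the top is a direct summand of a
sum of modules `Θ l` with `l ∈ S (i + j)`, and the extensions by `T` of each term of the
filtration come from its top layer. -/
def LinearlyLayered (Θ : Λ → ModuleCat.{u} A) (T : ModuleCat.{u} A) (S : ℕ → Set Λ) :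
    ℕ → ℕ → ModuleCat.{u} A → Prop
  | 0, _, M => IsZero M
  | n + 1, i, M => ∃ (N L : ModuleCat.{u} A) (f : N ⟶ M) (g : M ⟶ L) (w : f ≫ g = 0),
      (ShortComplex.mk f g w).ShortExact ∧ AddOf Θ (S i) L ∧ ExtSurj T g ∧
        LinearlyLayered Θ T S n (i + 1) N

/-- The elements of height `i`. -/
def level (i : ℕ) : Set Λ := {l | ht l = i}

variable {Θ : Λ → ModuleCat.{u} A} {T : ModuleCat.{u} A} {n i : ℕ}

theorem LinearlyLayered.layered {M : ModuleCat.{u} A} (h : LinearlyLayered Θ T level n i M) :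
    Layered Θ n i M := by
  induction n generalizing i M with
  | zero => exact h
  | succ n ih =>
    obtain ⟨N, L, f, g, w, S, hL, _, hN⟩ := h
    exact ⟨N, L, f, g, w, S, hL, ih hN⟩

-- Heights serve to establish the layering; the resolution only needs layers in add `Θ`, so they may
-- be forgotten and the starting index becomes arbitrary.
omit [PartialOrder Λ] in
theorem LinearlyLayered.mono {S : ℕ → Set Λ} {U : Set Λ} (hS : ∀ i, S i ⊆ U)
    {M : ModuleCat.{u} A} (h : LinearlyLayered Θ T S n i M) (i' : ℕ) :
    LinearlyLayered Θ T (fun _ => U) n i' M := by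
  induction n generalizing i i' M with
  | zero => exact h
  | succ n ih =>
    obtain ⟨N, L, f, g, w, S, hL, hg, hN⟩ := h
    exact ⟨N, L, f, g, w, S, hL.mono (hS i), hg, ih hN _⟩

omit [PartialOrder Λ] in
theorem LinearlyLayered.of_iso {S : ℕ → Set Λ} {M M' : ModuleCat.{u} A}
    (h : LinearlyLayered Θ T S n i M) (e : M' ≅ M) : LinearlyLayered Θ T S n i M' := by
  cases n with
  | zero => exact IsZero.of_iso h e
  | succ n =>
    obtain ⟨N, L, f, g, w, S, hL, hg, hN⟩ := h
    obtain ⟨w', S'⟩ := exact_of_iso S e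
    refine ⟨N, L, _, _, w', S', hL, fun t x => ?_, hN⟩
    obtain ⟨y, hy⟩ := hg t ((Ext.mk₀ e.inv).comp x (zero_add t))
    refine ⟨y, ?_⟩
    rw [← Ext.mk₀_comp_mk₀_assoc, hy, Ext.mk₀_comp_mk₀_assoc, e.hom_inv_id, Ext.mk₀_id_comp]

theorem ExtSurj.biproduct {J : Type*} [Finite J] {M L : J → ModuleCat.{u} A} {g : ∀ j, M j ⟶ L j}
    (h : ∀ j, ExtSurj T (g j)) : ExtSurj T (biproduct.map g) := by
  have := Fintype.ofFinite J
  intro t x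
  choose y hy using fun j => h j t ((Ext.mk₀ (biproduct.ι M j)).comp x (zero_add t))
  refine ⟨∑ j, (Ext.mk₀ (biproduct.π L j)).comp (y j) (zero_add t), ?_⟩
  conv_rhs => rw [← Ext.mk₀_id_comp x, ← biproduct_total, Ext.mk₀_sum, Ext.sum_comp]
  rw [Ext.comp_sum]
  refine Finset.sum_congr rfl fun j _ => ?_
  rw [Ext.mk₀_comp_mk₀_assoc, biproduct.map_π, ← Ext.mk₀_comp_mk₀_assoc, hy,
    Ext.mk₀_comp_mk₀_assoc]

theorem isZero_biproduct {J : Type*} [Finite J] {M : J → ModuleCat.{u} A}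
    (h : ∀ j, IsZero (M j)) : IsZero (⨁ M) := by
  rw [IsZero.iff_id_eq_zero]
  exact biproduct.hom_ext _ _ fun j => (h j).eq_of_tgt _ _

omit [PartialOrder Λ] in
theorem LinearlyLayered.biproduct {J : Type*} [Finite J] {S : ℕ → Set Λ} {M : J → ModuleCat.{u} A}
    (h : ∀ j, LinearlyLayered Θ T S n i (M j)) : LinearlyLayered Θ T S n i (⨁ M) := by
  induction n generalizing i M with
  | zero => exact isZero_biproduct h
  | succ n ih =>
    choose N L f g w S hL hg hN using h
    obtain ⟨w', S'⟩ := exact_biproduct S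
    exact ⟨_, _, _, _, w', S', AddOf.biproduct L hL, ExtSurj.biproduct hg, ih hN⟩

omit [PartialOrder Λ] in
theorem LinearlyLayered.of_isZero {S : ℕ → Set Λ} {M : ModuleCat.{u} A} (h : IsZero M) (n i : ℕ) :
    LinearlyLayered Θ T S n i M :=
  (LinearlyLayered.biproduct (J := PEmpty.{1}) (M := PEmpty.elim) (by rintro ⟨⟩)).of_iso
    (h.iso (isZero_biproduct (by rintro ⟨⟩)))

/-- Vanishing of Hom to lower heights makes `f` and `g` act on top layers and on the next terms;
vanishing of Ext makes the sequence of top layers split exact. Induction applies to the kernels, and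
a chase in the long exact sequences gives surjectivity for the top layer of `Z`. -/
theorem HeightDirected.linearlyLayered_cokernel (D : HeightDirected Θ) {X Y Z : ModuleCat.{u} A}
    {f : X ⟶ Y} {g : Y ⟶ Z} {w : f ≫ g = 0} (S : (ShortComplex.mk f g w).ShortExact)
    (hX : LinearlyLayered Θ T level n i X) (hY : LinearlyLayered Θ T level n i Y)
    (hZ : Layered Θ n i Z) : LinearlyLayered Θ T level n i Z ∧ ExtSurj T f := by
  induction n generalizing i X Y Z with
  | zero => exact ⟨hZ, fun t x => ⟨0, by rw [isZero_ext_eq_zero' hX x, Ext.comp_zero]⟩⟩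
  | succ n ih =>
    have hZ₀ := hZ
    obtain ⟨X', LX, fX, gX, wX, SX, hLX, sX, hX'⟩ := hX
    obtain ⟨Y', LY, fY, gY, wY, SY, hLY, sY, hY'⟩ := hY
    obtain ⟨Z', LZ, fZ, gZ, wZ, SZ, hLZ, hZ'⟩ := hZ
    have := exact_epi SX
    have := exact_epi SY
    have := exact_epi S
    obtain ⟨φL, hφL⟩ := exact_desc SX (f ≫ gY)
      (D.layered_hom_eq_zero hX'.layered hLY i.lt_succ_self _)
    obtain ⟨ψL, hψL⟩ := exact_desc SY (g ≫ gZ)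
      (D.layered_hom_eq_zero hY'.layered hLZ i.lt_succ_self _)
    obtain ⟨φN, hφN⟩ := exact_lift SY (fX ≫ f)
      (by rw [Category.assoc, ← hφL, reassoc_of% wX, zero_comp])
    obtain ⟨ψN, hψN⟩ := exact_lift SZ (fY ≫ g)
      (by rw [Category.assoc, ← hψL, reassoc_of% wY, zero_comp])
    -- `Ext^1(Z, LX) = 0`. The extension `k` of `gX` yields both the retraction `r` of `φL` and the
    -- surjectivity of restriction along `f`.
    obtain ⟨k, hk⟩ := exact_extend_of_ext S (D.layered_ext_eq_zero hZ₀ hLX le_rfl) gX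
    obtain ⟨r, hr⟩ := exact_desc SY k (D.layered_hom_eq_zero hY'.layered hLX i.lt_succ_self _)
    have hφr : φL ≫ r = 𝟙 _ := by
      rw [← cancel_epi gX, reassoc_of% hφL, hr, hk, Category.comp_id]
    obtain ⟨h', hh'⟩ := exact_desc S (gY ≫ (𝟙 LY - r ≫ φL)) (by
      rw [← Category.assoc, ← hφL, Category.assoc, Preadditive.comp_sub, reassoc_of% hφr,
        Category.comp_id, sub_self, comp_zero])
    obtain ⟨h, hh⟩ := exact_desc SZ h' (D.layered_hom_eq_zero hZ' hLY i.lt_succ_self _)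
    have hψh : ψL ≫ h = 𝟙 LY - r ≫ φL := by
      rw [← cancel_epi gY, reassoc_of% hψL, hh, hh']
    have wL : φL ≫ ψL = 0 := by
      rw [← cancel_epi gX, reassoc_of% hφL, hψL, reassoc_of% w, zero_comp, comp_zero]
    have SL : (ShortComplex.mk φL ψL wL).ShortExact := by
      refine shortExact_of_apply (fun x y hxy => ?_) (fun z => ?_) fun x hx => ⟨r x, ?_⟩
      · have h1 (x) : r (φL x) = x := congr($hφr x)
        rw [← h1 x, hxy, h1]
      · obtain ⟨z, rfl⟩ := exact_surj SZ z
        obtain ⟨y, rfl⟩ := exact_surj S z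
        exact ⟨gY y, congr($hψL y)⟩
      · have h1 : h (ψL x) = x - φL (r x) := congr($hψh x)
        rw [hx, map_zero, eq_comm, sub_eq_zero] at h1
        exact h1.symm
    obtain ⟨_, SN⟩ := exact_kernels SX SY SZ S SL hφN.symm hψN.symm hφL hψL
    obtain ⟨hZ'', sN⟩ := ih SN hX' hY' hZ'
    have sf : ExtSurj T f := sX.of_comp_eq k hk
    refine ⟨⟨Z', LZ, fZ, gZ, wZ, SZ, hLZ, fun t z => ?_, hZ''⟩, sf⟩
    obtain ⟨y, hy⟩ := sY t ((Ext.mk₀ g).comp z (zero_add t))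
    have h0 : (Ext.mk₀ gX).comp ((Ext.mk₀ φL).comp y (zero_add t)) (zero_add t) = 0 := by
      rw [Ext.mk₀_comp_mk₀_assoc, hφL, ← Ext.mk₀_comp_mk₀_assoc, hy, Ext.mk₀_comp_mk₀_assoc, w,
        Ext.mk₀_zero, Ext.zero_comp]
    -- The lift `y` may be nonzero on `LX`, but there it is a connecting image of some `v` on `X'`.
    -- By induction `v` extends to `Y'`, and subtracting the connecting image of the extension makes
    -- the lift vanish on `LX` without changing its restriction to `Y`.
    have hw : ∃ x : Ext LY T t, (Ext.mk₀ gY).comp x (zero_add t) =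
        (Ext.mk₀ g).comp z (zero_add t) ∧ (Ext.mk₀ φL).comp x (zero_add t) = 0 := by
      cases t with
      | zero =>
        refine ⟨y, hy, ?_⟩
        apply Ext.precomp_mk₀_injective_of_epi T gX
        simpa using h0
      | succ t =>
        obtain ⟨v, hv⟩ := Ext.contravariant_sequence_exact₃ SX T _ h0 (add_comm 1 t)
        obtain ⟨v', rfl⟩ := sN t v
        refine ⟨y - SY.extClass.comp v' (add_comm 1 t), ?_, ?_⟩
        · rw [sub_eq_add_neg, Ext.comp_add, Ext.comp_neg, hy]
          have := SY.comp_extClass_assoc v' (add_comm 1 t)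
          dsimp at this
          rw [this, neg_zero, add_zero]
        · rw [sub_eq_add_neg, Ext.comp_add, Ext.comp_neg,
            extClass_naturality_assoc SX SY hφN hφL.symm, hv, add_neg_cancel]
    obtain ⟨x, hx, hx0⟩ := hw
    obtain ⟨q, rfl⟩ := Ext.contravariant_sequence_exact₂ SL T x hx0
    refine ⟨q, ?_⟩
    dsimp at hx
    rw [← sub_eq_zero]
    -- Restriction along `g` is injective because restriction along `f` is onto, so it is enough to
    -- compare the classes on `Y`.
    apply sf.ext_inj S
    rw [sub_eq_add_neg, Ext.comp_add, Ext.comp_neg, Ext.mk₀_comp_mk₀_assoc, ← hψL,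
      ← Ext.mk₀_comp_mk₀_assoc, hx, add_neg_cancel]

end StratSystem

/-! ### Graded maps between the modules Ext^*(M, T), and degree shifts -/

noncomputable section

namespace YonedaExt

variable {A : Type u} [Ring A] {M M' M'' T : ModuleCat.{u} A}

theorem of_comp_eq {X Y Z : ModuleCat.{u} A} {a b c c' : ℕ} (x : Ext X Y a) (y : Ext Y Z b)
    (h : a + b = c) (h' : a + b = c') :
    DirectSum.of (Ext X Z) c (x.comp y h) = DirectSum.of (Ext X Z) c' (x.comp y h') := by
  subst h; subst h'; rfl

theorem of_smul_of {i j : ℕ} (γ : Ext T T i) (x : Ext M T j) :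
    (DirectSum.of (Ext T T) i γ : ExtAlg T) • (DirectSum.of (Ext M T) j x : ExtMod M T) =
      DirectSum.of (Ext M T) (i + j) (x.comp γ (add_comm j i)) :=
  DirectSum.Gmodule.of_smul_of _ _ γ x

/-- Composition with a fixed extension, as a map of abelian groups. -/
def precompHom (T : ModuleCat.{u} A) {a : ℕ} (κ : Ext M' M a) : ExtMod M T →+ ExtMod M' T :=
  DirectSum.toAddMonoid fun j => (DirectSum.of (Ext M' T) (a + j)).comp (κ.precomp T rfl)

theorem precompHom_of {a j : ℕ} (κ : Ext M' M a) (x : Ext M T j) :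
    precompHom T κ (DirectSum.of (Ext M T) j x) =
      DirectSum.of (Ext M' T) (a + j) (κ.comp x rfl) :=
  DirectSum.toAddMonoid_of _ _ _

theorem precompHom_smul {a : ℕ} (κ : Ext M' M a) (r : ExtAlg T) (x : ExtMod M T) :
    precompHom T κ (r • x) = r • precompHom T κ x := by
  induction r using DirectSum.induction_on with
  | zero => rw [zero_smul, zero_smul, map_zero]
  | add r s hr hs => rw [add_smul, map_add, hr, hs, add_smul]
  | of i γ =>
    induction x using DirectSum.induction_on with
    | zero => rw [smul_zero, map_zero, smul_zero]
    | add x y hx hy => rw [smul_add, map_add, hx, hy, map_add, smul_add]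
    | of j x =>
      rw [of_smul_of, precompHom_of, precompHom_of, of_smul_of,
        ← of_comp_eq (κ.comp x rfl) γ (by omega : a + j + i = a + (i + j)), Ext.comp_assoc]
      omega

/-- Composition with a fixed extension, as a map of modules over `Ext^*(T, T)`. -/
def precomp (T : ModuleCat.{u} A) {a : ℕ} (κ : Ext M' M a) : ExtMod M T →ₗ[ExtAlg T] ExtMod M' T where
  __ := precompHom T κ
  map_smul' := precompHom_smul κ

theorem precomp_of {a j c : ℕ} (κ : Ext M' M a) (x : Ext M T j) (h : a + j = c) :
    precomp T κ (DirectSum.of (Ext M T) j x) = DirectSum.of (Ext M' T) c (κ.comp x h) := by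
  subst h
  exact precompHom_of κ x

theorem precomp_apply {a j c : ℕ} (κ : Ext M' M a) (x : ExtMod M T) (h : a + j = c) :
    precomp T κ x c = κ.comp (x j) h := by
  induction x using DirectSum.induction_on with
  | zero => simp
  | add x y hx hy => rw [map_add, DirectSum.add_apply, hx, hy, DirectSum.add_apply, Ext.comp_add]
  | of i x =>
    rw [precomp_of κ x rfl]
    by_cases hij : i = j
    · subst hij
      subst h
      rw [DirectSum.of_eq_same, DirectSum.of_eq_same]
    · rw [DirectSum.of_eq_of_ne _ _ _ (by omega), DirectSum.of_eq_of_ne _ _ _ (by omega),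
        Ext.comp_zero]

theorem precomp_apply_of_lt {a c : ℕ} (κ : Ext M' M a) (x : ExtMod M T) (h : c < a) :
    precomp T κ x c = 0 := by
  induction x using DirectSum.induction_on with
  | zero => simp
  | add x y hx hy => rw [map_add, DirectSum.add_apply, hx, hy, add_zero]
  | of i x => rw [precomp_of κ x rfl, DirectSum.of_eq_of_ne _ _ _ (by omega)]

theorem precomp_precomp {a b c : ℕ} (κ : Ext M' M a) (κ' : Ext M'' M' b) (h : b + a = c)
    (x : ExtMod M T) : precomp T κ' (precomp T κ x) = precomp T (κ'.comp κ h) x := by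
  induction x using DirectSum.induction_on with
  | zero => simp
  | add x y hx hy => rw [map_add, map_add, hx, hy, map_add]
  | of i x =>
    rw [precomp_of κ x rfl, precomp_of κ' _ rfl, precomp_of (κ'.comp κ h) x rfl,
      ← of_comp_eq _ _ (by omega : c + i = b + (a + i)), Ext.comp_assoc]
    omega

theorem precomp_add {a : ℕ} (κ κ' : Ext M' M a) (x : ExtMod M T) :
    precomp T (κ + κ') x = precomp T κ x + precomp T κ' x := by
  induction x using DirectSum.induction_on with
  | zero => simp
  | add x y hx hy => rw [map_add, hx, hy, map_add, map_add]; abel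
  | of i x => rw [precomp_of _ x rfl, precomp_of _ x rfl, precomp_of _ x rfl, Ext.add_comp, map_add]

theorem precomp_zero {a : ℕ} (x : ExtMod M T) : precomp T (0 : Ext M' M a) x = 0 := by
  simpa using precomp_add (0 : Ext M' M a) 0 x

theorem precomp_neg {a : ℕ} (κ : Ext M' M a) (x : ExtMod M T) :
    precomp T (-κ) x = - precomp T κ x := by
  rw [eq_neg_iff_add_eq_zero, ← precomp_add, neg_add_cancel, precomp_zero]

theorem precomp_id (x : ExtMod M T) : precomp T (Ext.mk₀ (𝟙 M)) x = x := by
  induction x using DirectSum.induction_on with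
  | zero => simp
  | add x y hx hy => rw [map_add, hx, hy]
  | of i x => rw [precomp_of _ x (zero_add i), Ext.mk₀_id_comp]

section shift

variable (B : ℕ → Type*) [∀ i, AddCommGroup (B i)]

/-- The homogeneous elements of degree `i - s` of a direct sum. -/
def shiftPart (s i : ℕ) : AddSubgroup (DirectSum ℕ B) where
  carrier := {x | ∀ j, j + s ≠ i → x j = 0}
  zero_mem' _ _ := rfl
  add_mem' hx hy j hj := by rw [DirectSum.add_apply, hx j hj, hy j hj, add_zero]
  neg_mem' {x} hx j hj := by
    have := congrArg Neg.neg (hx j hj)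
    rwa [neg_zero] at this

variable {B}

theorem of_mem_shiftPart {s j i : ℕ} (h : j + s = i) (x : B j) :
    DirectSum.of B j x ∈ shiftPart B s i := by
  intro j' hj'
  exact DirectSum.of_eq_of_ne _ _ _ (by omega)

theorem eq_of_mem_shiftPart {s j i : ℕ} (h : j + s = i) {x : DirectSum ℕ B}
    (hx : x ∈ shiftPart B s i) : DirectSum.of B j (x j) = x := by
  refine DFinsupp.ext fun j' => ?_
  by_cases hj : j' = j
  · subst hj
    exact DirectSum.of_eq_same _ _
  · rw [hx j' (by omega)]
    exact DirectSum.of_eq_of_ne _ _ _ hj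

theorem shiftPart_coe_apply (s : ℕ) (y : DirectSum ℕ fun i => shiftPart B s i) (j : ℕ) :
    DirectSum.coeAddMonoidHom (shiftPart B s) y j = (y (j + s) : DirectSum ℕ B) j := by
  induction y using DirectSum.induction_on with
  | zero => rw [map_zero]; rfl
  | add x y hx hy =>
    rw [map_add, DirectSum.add_apply, hx, hy, DirectSum.add_apply]
    rfl
  | of i x =>
    rw [DirectSum.coeAddMonoidHom_of]
    by_cases h : j + s = i
    · subst h
      rw [DirectSum.of_eq_same]
    · rw [DirectSum.of_eq_of_ne _ _ _ h, x.2 j h]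
      rfl

theorem shiftPart_isInternal (s : ℕ) : DirectSum.IsInternal (shiftPart B s) := by
  constructor
  · rw [injective_iff_map_eq_zero]
    intro y hy
    refine DFinsupp.ext fun i => Subtype.ext (DFinsupp.ext fun j => ?_)
    by_cases h : j + s = i
    · subst h
      rw [← shiftPart_coe_apply, hy]
      rfl
    · exact (y i).2 j h
  · intro x
    induction x using DirectSum.induction_on with
    | zero => exact ⟨0, map_zero _⟩
    | add x y hx hy =>
      obtain ⟨x', rfl⟩ := hx
      obtain ⟨y', rfl⟩ := hy
      exact ⟨x' + y', map_add _ _ _⟩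
    | of j x =>
      exact ⟨DirectSum.of (fun i => shiftPart B s i) (j + s) ⟨_, of_mem_shiftPart rfl x⟩,
        DirectSum.coeAddMonoidHom_of _ _ _⟩

end shift

theorem modPart_eq_shiftPart (i : ℕ) : modPart M T i = shiftPart (Ext M T) 0 i := by
  ext x
  constructor
  · rintro ⟨y, rfl⟩
    exact of_mem_shiftPart rfl y
  · exact fun hx => ⟨x i, eq_of_mem_shiftPart rfl hx⟩

theorem precomp_mem {a s s' i : ℕ} (κ : Ext M' M a) (h : s = a + s') {x : ExtMod M T}
    (hx : x ∈ shiftPart (Ext M T) s i) : precomp T κ x ∈ shiftPart (Ext M' T) s' i := by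
  intro j hj
  by_cases hja : j < a
  · exact precomp_apply_of_lt κ x hja
  · rw [precomp_apply κ x (Nat.add_sub_cancel' (not_lt.1 hja)), hx _ (by omega), Ext.comp_zero]

theorem shiftPart_gradedSMul (k : Type v) [Field k] [Algebra k A] (s : ℕ) :
    SetLike.GradedSMul (algPart k T) (shiftPart (Ext M T) s) where
  smul_mem {i m _ x} := by
    rintro ⟨γ, rfl⟩ hx
    by_cases hm : m < s
    · have : x = 0 := DFinsupp.ext fun j => hx j (by omega)
      rw [this, smul_zero]
      exact zero_mem _
    · rw [← eq_of_mem_shiftPart (Nat.sub_add_cancel (not_lt.1 hm)) hx]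
      have : (DirectSum.lof k ℕ (Ext T T) i γ : ExtAlg T) • DirectSum.of (Ext M T) (m - s) (x (m - s))
          = DirectSum.of (Ext M T) (i + (m - s)) ((x (m - s)).comp γ (add_comm _ _)) :=
        DirectSum.Gmodule.of_smul_of _ _ γ _
      rw [this]
      refine of_mem_shiftPart ?_ _
      simp only [vadd_eq_add]
      omega

end YonedaExt

end

/-! ### Projectivity of Ext^*(L, T) for L in add Θ, and the spliced resolution -/

noncomputable section

namespace YonedaExt

open StratSystem

variable {A : Type u} [Ring A] {M M' N L T : ModuleCat.{u} A}

theorem smul_eq_mul (r x : ExtAlg T) : r • (x : ExtMod T T) = r * x := by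
  induction r using DirectSum.induction_on with
  | zero => rw [zero_smul, zero_mul]
  | add r s hr hs => rw [add_smul, hr, hs, add_mul]
  | of i γ =>
    induction x using DirectSum.induction_on with
    | zero => rw [smul_zero, mul_zero]
    | add x y hx hy => rw [smul_add, hx, hy, mul_add]
    | of j x => exact (of_smul_of γ x).trans (DirectSum.of_mul_of γ x).symm

theorem smul_of_mk₀ (r : ExtAlg T) (c : M ⟶ T) :
    r • (DirectSum.of (Ext M T) 0 (Ext.mk₀ c) : ExtMod M T) = precomp T (Ext.mk₀ c) r := by
  induction r using DirectSum.induction_on with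
  | zero => rw [zero_smul, map_zero]
  | add r s hr hs => rw [add_smul, map_add, hr, hs]
  | of i γ => rw [of_smul_of, precomp_of _ γ (add_comm 0 i)]

/-- Restriction to `T`, with values in the algebra. -/
def precompAlg (c : T ⟶ M) : ExtMod M T →ₗ[ExtAlg T] ExtAlg T where
  toFun x := precomp T (Ext.mk₀ c) x
  map_add' := map_add _
  map_smul' r x := by
    rw [map_smul]
    exact smul_eq_mul r _

/-- An element of the direct sum has finite support, so preimages can be chosen degree by degree;
degrees below `a` receive nothing. -/
theorem exists_precomp_eq {a : ℕ} (κ : Ext M' M a) (y : ExtMod M' T) (h0 : ∀ i < a, y i = 0)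
    (h : ∀ i j, ∀ hj : a + j = i, ∃ x : Ext M T j, κ.comp x hj = y i) : ∃ x, precomp T κ x = y := by
  classical
  change y ∈ LinearMap.range (precomp T κ)
  rw [← DirectSum.sum_support_of y]
  refine sum_mem fun i _ => ?_
  by_cases hi : i < a
  · rw [h0 i hi, map_zero]
    exact zero_mem _
  · obtain ⟨j, rfl⟩ := Nat.exists_eq_add_of_le (not_lt.1 hi)
    obtain ⟨x, hx⟩ := h _ j rfl
    exact ⟨DirectSum.of _ j x, by rw [precomp_of κ x rfl, hx]⟩

section exact

variable {f : N ⟶ M} {g : M ⟶ L} {w : f ≫ g = 0} (S : (ShortComplex.mk f g w).ShortExact)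
  (hg : ExtSurj T g)

include hg in
theorem precomp_surjective : Function.Surjective (precomp T (Ext.mk₀ g)) := by
  intro y
  refine exists_precomp_eq _ y (fun i hi => by omega) fun i j hj => ?_
  obtain rfl : j = i := by omega
  exact hg j (y j)

-- The kernel of the connecting map consists of restrictions of classes from `M`. These come from
-- `L`, and the composite `N → M → L` is zero.
include hg in
theorem precomp_extClass_injective : Function.Injective (precomp T S.extClass) := by
  rw [injective_iff_map_eq_zero]
  intro x hx
  refine DFinsupp.ext fun j => ?_
  have h : S.extClass.comp (x j) rfl = 0 := by
    rw [← precomp_apply S.extClass x rfl, hx]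
    rfl
  obtain ⟨y, hy⟩ := Ext.contravariant_sequence_exact₁ S T (x j) rfl h
  obtain ⟨z, rfl⟩ := hg j y
  rw [← hy]
  dsimp
  rw [Ext.mk₀_comp_mk₀_assoc, w, Ext.mk₀_zero, Ext.zero_comp]

theorem precomp_exact : Function.Exact (precomp T S.extClass) (precomp T (Ext.mk₀ g)) := by
  intro y
  constructor
  · intro hy
    have h (i : ℕ) : (Ext.mk₀ g).comp (y i) (zero_add i) = 0 := by
      rw [← precomp_apply (Ext.mk₀ g) y (zero_add i), hy]
      rfl
    refine exists_precomp_eq _ y (fun i hi => ?_) fun i j hj => ?_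
    -- The connecting map has no source for degree zero; there `g` being epi forces `y 0 = 0`.
    · obtain rfl : i = 0 := by omega
      have := exact_epi S
      apply Ext.precomp_mk₀_injective_of_epi T g
      simpa using h 0
    · exact Ext.contravariant_sequence_exact₃ S T (y i) (h _) hj
  · rintro ⟨x, rfl⟩
    have : (Ext.mk₀ g).comp S.extClass (zero_add 1) = 0 := S.comp_extClass
    rw [precomp_precomp _ _ (zero_add 1), this, precomp_zero]

end exact

variable {Λ : Type w} [Fintype Λ] (Θ : Λ → ModuleCat.{u} A)

/-- A composite `L → Θ l → L` contributes one pair: `Θ l` is a summand of `⨁ Θ`, so restriction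
along `⨁ Θ → Θ l → L` takes values in the algebra, and `L → Θ l → ⨁ Θ` is an element of degree zero.
The identity of `L` is a signed sum of such composites. Finiteness, projectivity and generation in
degree zero all follow from this basis. -/
theorem exists_dualBasis (h : AddOf Θ Set.univ L) :
    ∃ (ι : Type) (_ : Fintype ι) (φ : ι → ExtMod L (⨁ Θ) →ₗ[ExtAlg (⨁ Θ)] ExtAlg (⨁ Θ))
      (b : ι → Ext L (⨁ Θ) 0), ∀ x, ∑ j, φ j x • DirectSum.of (Ext L (⨁ Θ)) 0 (b j) = x := by
  have key : ∀ g ∈ through Θ Set.univ L L, ∃ (ι : Type) (_ : Fintype ι)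
      (φ : ι → ExtMod L (⨁ Θ) →ₗ[ExtAlg (⨁ Θ)] ExtAlg (⨁ Θ)) (b : ι → Ext L (⨁ Θ) 0),
      ∀ x, ∑ j, φ j x • DirectSum.of (Ext L (⨁ Θ)) 0 (b j) = precomp (⨁ Θ) (Ext.mk₀ g) x := by
    intro g hg
    induction hg using AddSubgroup.closure_induction with
    | mem g hg =>
      obtain ⟨l, -, a, b, rfl⟩ := hg
      refine ⟨Unit, inferInstance, fun _ => precompAlg (biproduct.π Θ l ≫ b),
        fun _ => Ext.mk₀ (a ≫ biproduct.ι Θ l), fun x => ?_⟩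
      rw [Fintype.sum_unique, smul_of_mk₀]
      refine (precomp_precomp _ _ (add_zero 0) x).trans ?_
      rw [Ext.mk₀_comp_mk₀, Category.assoc, biproduct.ι_π_self_assoc]
    | zero =>
      refine ⟨Empty, inferInstance, Empty.elim, Empty.elim, fun x => ?_⟩
      rw [Ext.mk₀_zero, precomp_zero, Finset.univ_eq_empty, Finset.sum_empty]
    | add g g' _ _ hg hg' =>
      obtain ⟨ι, _, φ, b, h⟩ := hg
      obtain ⟨ι', _, φ', b', h'⟩ := hg'
      refine ⟨ι ⊕ ι', inferInstance, Sum.elim φ φ', Sum.elim b b', fun x => ?_⟩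
      rw [Fintype.sum_sum_type, Ext.mk₀_add, precomp_add, ← h, ← h']
      rfl
    | neg g _ hg =>
      obtain ⟨ι, _, φ, b, h⟩ := hg
      refine ⟨ι, inferInstance, fun j => - φ j, b, fun x => ?_⟩
      rw [Ext.mk₀_neg, precomp_neg, ← h, ← Finset.sum_neg_distrib]
      exact Finset.sum_congr rfl fun j _ => by rw [LinearMap.neg_apply, neg_smul]
  obtain ⟨ι, _, φ, b, h⟩ := key _ h
  exact ⟨ι, inferInstance, φ, b, fun x => (h x).trans (precomp_id x)⟩

variable {Θ}

theorem extMod_projective (h : AddOf Θ Set.univ L) :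
    Module.Projective (ExtAlg (⨁ Θ)) (ExtMod L (⨁ Θ)) := by
  obtain ⟨ι, _, φ, b, h⟩ := exists_dualBasis Θ h
  refine Module.Projective.of_split (LinearMap.pi φ)
    (Fintype.linearCombination (ExtAlg (⨁ Θ)) fun j => DirectSum.of (Ext L (⨁ Θ)) 0 (b j))
    (LinearMap.ext fun x => ?_)
  simpa [Fintype.linearCombination_apply] using h x

theorem extMod_finite (h : AddOf Θ Set.univ L) :
    Module.Finite (ExtAlg (⨁ Θ)) (ExtMod L (⨁ Θ)) := by
  obtain ⟨ι, _, φ, b, h⟩ := exists_dualBasis Θ h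
  refine Module.Finite.of_surjective
    (Fintype.linearCombination (ExtAlg (⨁ Θ)) fun j => DirectSum.of (Ext L (⨁ Θ)) 0 (b j))
    fun x => ⟨fun j => φ j x, ?_⟩
  simpa [Fintype.linearCombination_apply] using h x

theorem extMod_span (h : AddOf Θ Set.univ L) (s : ℕ) :
    Submodule.span (ExtAlg (⨁ Θ)) (shiftPart (Ext L (⨁ Θ)) s s : Set (ExtMod L (⨁ Θ))) = ⊤ := by
  obtain ⟨ι, _, φ, b, h⟩ := exists_dualBasis Θ h
  refine eq_top_iff.2 fun x _ => ?_
  rw [← h x]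
  exact sum_mem fun j _ => Submodule.smul_mem _ _
    (Submodule.subset_span (of_mem_shiftPart (zero_add s) (b j)))

variable [PartialOrder Λ]

-- The differential restricts from the layer `L (s + 1)` to the corresponding term of the filtration
-- and then applies the connecting map into `Ext^*` of the layer `L s`. The latter raises the Ext
-- degree by one while the shift drops by one, so the internal degree is preserved.
omit [PartialOrder Λ] in
theorem hasLinearProjectiveResolution (k : Type v) [Field k] [Algebra k A] {n : ℕ}
    (hM : LinearlyLayered Θ (⨁ Θ) (fun _ => Set.univ) n 0 M) :
    HasLinearProjectiveResolution (algPart k (⨁ Θ)) (modPart M (⨁ Θ)) := by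
  let X := {M : ModuleCat.{u} A // ∃ n i, LinearlyLayered Θ (⨁ Θ) (fun _ => Set.univ) n i M}
  have step : ∀ M : X, ∃ (N : X) (L : ModuleCat.{u} A) (f : N.1 ⟶ M.1) (g : M.1 ⟶ L)
      (w : f ≫ g = 0), (ShortComplex.mk f g w).ShortExact ∧ AddOf Θ Set.univ L ∧
        ExtSurj (⨁ Θ) g := by
    rintro ⟨M, n, i, hM⟩
    cases n with
    | zero =>
      -- A zero module still has a trivial layer, so the chain of terms never stops.
      obtain ⟨N, L, f, g, w, S, hL, hg, hN⟩ := LinearlyLayered.of_isZero (Θ := Θ) (T := ⨁ Θ)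
        (S := fun _ => Set.univ) hM 1 i
      exact ⟨⟨N, 0, i + 1, hN⟩, L, f, g, w, S, hL, hg⟩
    | succ n =>
      obtain ⟨N, L, f, g, w, S, hL, hg, hN⟩ := hM
      exact ⟨⟨N, n, i + 1, hN⟩, L, f, g, w, S, hL, hg⟩
  choose next L f g w S hL hg using step
  let seq : ℕ → X := fun s => Nat.rec ⟨M, n, 0, hM⟩ (fun _ M => next M) s
  refine ⟨fun s => ExtMod (L (seq s)) (⨁ Θ), fun s => inferInstance, fun s => inferInstance,
    fun s => shiftPart (Ext (L (seq s)) (⨁ Θ)) s,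
    fun s => precomp (⨁ Θ) (S (seq s)).extClass ∘ₗ precomp (⨁ Θ) (Ext.mk₀ (g (seq (s + 1)))),
    precomp (⨁ Θ) (Ext.mk₀ (g (seq 0))), fun s => ⟨shiftPart_isInternal s,
      shiftPart_gradedSMul k s, extMod_finite (hL _), extMod_projective (hL _),
      extMod_span (hL _) s⟩, fun s i x hx => ?_, fun i x hx => ?_, precomp_surjective (hg _),
      ?_, fun s => ?_⟩
  · exact precomp_mem _ (add_comm s 1) (precomp_mem _ (zero_add _).symm hx)
  · rw [modPart_eq_shiftPart]
    exact precomp_mem _ rfl hx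
  · exact (precomp_surjective (hg _)).comp_exact_iff_exact.2 (precomp_exact (S _))
  · refine (precomp_surjective (hg _)).comp_exact_iff_exact.2 ?_
    exact (precomp_extClass_injective (S _) (hg _)).comp_exact_iff_exact.2 (precomp_exact (S _))

end YonedaExt

end

/-! ### Finite-dimensionality and the degree zero part of the Yoneda algebra -/

namespace YonedaExt

theorem finite_biproduct {A : Type u} [Ring A] {J : Type*} [Finite J] (X : J → ModuleCat.{u} A)
    [∀ j, Module.Finite A (X j)] : Module.Finite A (⨁ X : ModuleCat.{u} A) := by
  have := Fintype.ofFinite J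
  refine ⟨?_⟩
  have : (⊤ : Submodule A (⨁ X : ModuleCat.{u} A)) =
      ⨆ j, LinearMap.range (biproduct.ι X j).hom := by
    refine (top_le_iff.1 fun x _ => ?_).symm
    have h := congr($(StratSystem.biproduct_total X) x)
    change ModuleCat.Hom.hom _ x = x at h
    rw [ModuleCat.hom_sum, LinearMap.sum_apply] at h
    rw [← h]
    exact sum_mem fun j _ => Submodule.mem_iSup_of_mem j ⟨biproduct.π X j x, rfl⟩
  rw [this]
  exact Submodule.fg_iSup _ fun j => (Submodule.fg_range _)

variable (k : Type v) [Field k] {A : Type u} [Ring A] [Algebra k A] [Module.Finite k A]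

theorem finite_hom (M N : ModuleCat.{u} A) [Module.Finite A M] [Module.Finite A N] :
    Module.Finite k (M ⟶ N) := by
  let _ : Module k M := ModuleCat.moduleOfAlgebraModule M
  let _ : Module k N := ModuleCat.moduleOfAlgebraModule N
  have : IsScalarTower k A M := ModuleCat.isScalarTower_of_algebra_moduleCat M
  have : IsScalarTower k A N := ModuleCat.isScalarTower_of_algebra_moduleCat N
  have : Module.Finite k M := Module.Finite.trans A _
  have : Module.Finite k N := Module.Finite.trans A _
  let φ : (M ⟶ N) →ₗ[k] (M →ₗ[k] N) :=
    { toFun f := f.hom.restrictScalars k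
      map_add' _ _ := rfl
      map_smul' _ _ := rfl }
  exact Module.Finite.of_injective φ fun f g h => by
    ext x
    exact congr($h x)

theorem finite_ext (M N : ModuleCat.{u} A) [Module.Finite A M] [Module.Finite A N] (i : ℕ) :
    Module.Finite k (Ext M N i) := by
  have : IsNoetherianRing A := isNoetherian_of_tower k inferInstance
  induction i generalizing M with
  | zero =>
    have := finite_hom k M N
    exact Module.Finite.equiv (Ext.linearEquiv₀ (R := k)).symm
  | succ n ih =>
    obtain ⟨m, f, surjf⟩ := Module.Finite.exists_fin' A M
    let exac := LinearMap.shortExact_shortComplexKer surjf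
    have := ih f.shortComplexKer.X₁
    exact Module.Finite.of_surjective (exac.extClass.precompOfLinear k _ (add_comm 1 n))
      (precomp_extClass_surjective_of_projective_X₂ _ exac n)

theorem finite_algPart (X : ModuleCat.{u} A) [Module.Finite A X] (i : ℕ) :
    Module.Finite k (algPart k X i) := by
  have := finite_ext k X X i
  exact Module.Finite.range _

include k in
/-- If `Hom(Q, T)` and `Hom(T, T)` are isomorphic over the endomorphism algebra of `T`, then every
morphism to `T` from a summand of `Q` factors through the given epimorphism. -/
theorem exists_comp_eq {Λ : Type w} [Finite Λ] {Θ Q : Λ → ModuleCat.{u} A}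
    [∀ l, Module.Finite A (Θ l)] (p : ∀ l, Q l ⟶ Θ l) [∀ l, Epi (p l)]
    (e : (⨁ Q ⟶ ⨁ Θ) ≃+ (⨁ Θ ⟶ ⨁ Θ))
    (he : ∀ (f : ⨁ Q ⟶ ⨁ Θ) (g : ⨁ Θ ⟶ ⨁ Θ), e (f ≫ g) = e f ≫ g) (l : Λ)
    (f : Q l ⟶ ⨁ Θ) : ∃ g : Θ l ⟶ ⨁ Θ, p l ≫ g = f := by
  have := finite_biproduct Θ
  have := finite_hom k (⨁ Θ) (⨁ Θ)
  -- Let `p'` be `biproduct.map p`. Since `p'` is epi and `e` injective, `g ↦ e p' ≫ g` is injective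
  -- on the finite-dimensional space `End (⨁ Θ)`, hence onto. So `e f' = e p' ≫ g = e (p' ≫ g)` for
  -- some `g`, whatever `f'` is.
  have hinj : Function.Injective (Linear.leftComp k (⨁ Θ) (e (biproduct.map p))) := by
    rw [injective_iff_map_eq_zero]
    intro g hg
    rw [Linear.leftComp_apply, ← he, EmbeddingLike.map_eq_zero_iff] at hg
    exact (cancel_epi (biproduct.map p)).1 (hg.trans comp_zero.symm)
  obtain ⟨g, hg⟩ := LinearMap.injective_iff_surjective.1 hinj (e (biproduct.π Q l ≫ f))
  rw [Linear.leftComp_apply, ← he] at hg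
  have := congr(biproduct.ι Q l ≫ $(e.injective hg))
  refine ⟨biproduct.ι Θ l ≫ g, ?_⟩
  rwa [biproduct.ι_map_assoc, biproduct.ι_π_self_assoc] at this

theorem _root_.HasLinearProjectiveResolution.congr {R : Type u} [Ring R] {σ : Type*} [SetLike σ R]
    {𝒜 : ℕ → σ} {N N' : Type*} [AddCommGroup N] [Module R N] [AddCommGroup N'] [Module R N']
    {𝒩 : ℕ → AddSubgroup N} {𝒩' : ℕ → AddSubgroup N'} (h : HasLinearProjectiveResolution 𝒜 𝒩)
    (e : N ≃ₗ[R] N') (he : ∀ i, ∀ x ∈ 𝒩 i, e x ∈ 𝒩' i) : HasLinearProjectiveResolution 𝒜 𝒩' := by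
  obtain ⟨P, i₁, i₂, G, d, ε, h₁, h₂, h₃, h₄, h₅, h₆⟩ := h
  refine ⟨P, i₁, i₂, G, d, e.toLinearMap ∘ₗ ε, h₁, h₂, fun i x hx => he i _ (h₃ i x hx),
    e.surjective.comp h₄, ?_, h₆⟩
  exact e.injective.comp_exact_iff_exact.2 h₅

omit [Module.Finite k A] in
/-- The degree zero part of `Ext^*(T, T)` is `Ext^*(P, T)` if the latter is concentrated in degree
zero and given by the morphisms that factor through `q`. -/
theorem hasLinearProjectiveResolution_zero {P T : ModuleCat.{u} A} (q : P ⟶ T) [Epi q]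
    (hq : ∀ f : P ⟶ T, ∃ g, q ≫ g = f) (h0 : ∀ i, 1 ≤ i → ∀ x : Ext P T i, x = 0)
    (h : HasLinearProjectiveResolution (algPart k T) (modPart P T)) :
    letI : Module (ExtAlg T) (algPart k T 0) :=
      Module.compHom (algPart k T 0) (GradedRing.projZeroRingHom' (algPart k T))
    HasLinearProjectiveResolution (algPart k T)
      (fun i => if i = 0 then (⊤ : AddSubgroup (algPart k T 0)) else ⊥) := by
  let _ : Module (ExtAlg T) (algPart k T 0) :=
    Module.compHom (algPart k T 0) (GradedRing.projZeroRingHom' (algPart k T))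
  have hof (x : ExtMod P T) : DirectSum.of (Ext P T) 0 (x 0) = x := by
    refine eq_of_mem_shiftPart (s := 0) (i := 0) rfl fun j hj => h0 j (by omega) _
  have key (r : ExtAlg T) (a : algPart k T 0) : precomp T (Ext.mk₀ q) (r • a : algPart k T 0).1 =
      r • precomp T (Ext.mk₀ q) a.1 := by
    obtain ⟨_, α, rfl⟩ := a
    have hs (r : ExtAlg T) : (r • (⟨_, α, rfl⟩ : algPart k T 0) : algPart k T 0).1 =
        (GradedRing.projZeroRingHom' (algPart k T) r).1 * DirectSum.lof k ℕ (Ext T T) 0 α := rfl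
    rw [hs]
    induction r using DirectSum.induction_on with
    | zero => rw [map_zero, zero_smul, Submodule.coe_zero, zero_mul, map_zero]
    | add r s hr hs => rw [map_add, add_smul, Submodule.coe_add, add_mul, map_add, hr, hs]
    | of i γ =>
      rw [← map_smul]
      -- For positive `i`, the left side dies under projection to degree zero and the right side
      -- lies in `Ext^i(P, T) = 0`.
      by_cases hi : i = 0
      · subst hi
        congr 1
        rw [smul_eq_mul]
        congr 1
        exact DirectSum.decompose_of_mem_same (algPart k T) (⟨γ, rfl⟩ : DirectSum.of (Ext T T) 0 γ ∈ algPart k T 0)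
      · have : (GradedRing.projZeroRingHom' (algPart k T) (DirectSum.of (Ext T T) i γ)).1 = 0 :=
          DirectSum.decompose_of_mem_ne (algPart k T) (⟨γ, rfl⟩ : DirectSum.of (Ext T T) i γ ∈ algPart k T i) hi
        rw [this, zero_mul, map_zero]
        erw [of_smul_of]
        exact ((precomp_of _ _ (zero_add _)).trans ((congrArg _ (h0 (i + 0) (by omega) _)).trans
          (map_zero _))).symm
  let φ : algPart k T 0 →ₗ[ExtAlg T] ExtMod P T :=
    { toFun a := precomp T (Ext.mk₀ q) a.1
      map_add' a b := map_add (precomp T (Ext.mk₀ q)) a.1 b.1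
      map_smul' := key }
  have hφ : Function.Bijective φ := by
    constructor
    · rw [injective_iff_map_eq_zero]
      rintro ⟨_, α, rfl⟩ h
      have h1 : precomp T (Ext.mk₀ q) (DirectSum.of (Ext T T) 0 α) = 0 := h
      rw [precomp_of _ α (zero_add 0)] at h1
      have h2 : (Ext.mk₀ q).comp α (zero_add 0) = 0 := DirectSum.of_injective 0 (h1.trans (map_zero _).symm)
      have : α = 0 := by
        apply Ext.precomp_mk₀_injective_of_epi T q
        simpa using h2
      subst this
      exact Subtype.ext (map_zero _)
    · intro x
      obtain ⟨f, hf⟩ := (Ext.mk₀_bijective _ _).2 (x 0)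
      obtain ⟨g, rfl⟩ := hq f
      refine ⟨⟨_, Ext.mk₀ g, rfl⟩, ?_⟩
      have h1 : precomp T (Ext.mk₀ q) (DirectSum.of (Ext T T) 0 (Ext.mk₀ g)) = x := by
        rw [precomp_of _ _ (zero_add 0), Ext.mk₀_comp_mk₀, hf, hof]
      exact h1
  refine h.congr (LinearEquiv.ofBijective φ hφ).symm fun i x hx => ?_
  split_ifs with hi
  · exact AddSubgroup.mem_top _
  · obtain ⟨y, rfl⟩ := hx
    rw [h0 i (by omega) y, map_zero, map_zero]
    exact zero_mem _

end YonedaExt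

namespace StratSystem

variable {A : Type u} [Ring A]

/-! ### Splitting of surjections -/

/-- Nakayama: a proper submodule of a finite module lies in a maximal one, which also contains the
radical. -/
theorem eq_top_of_sup_jacobson {M : Type*} [AddCommGroup M] [Module A M] [Module.Finite A M]
    (N : Submodule A M) (h : N ⊔ Module.jacobson A M = ⊤) : N = ⊤ := by
  obtain h' | ⟨m, hm, hN⟩ := eq_top_or_exists_le_coatom N
  · exact h'
  · refine absurd ?_ hm.1
    rw [← top_le_iff, ← h]
    exact sup_le hN (sInf_le hm)

/-- Every surjection from `L` to `X` splits. -/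
def SplitsOnto (L X : ModuleCat.{u} A) : Prop :=
  ∀ f : L ⟶ X, Function.Surjective f → ∃ c : X ⟶ L, c ≫ f = 𝟙 X

/-- The section is built one summand at a time. The endomorphism `ε` kills the components already
split, yet `ε ≫ f` still reaches `X j₀`, because `ε` fixes preimages of elements of `X j₀`. A
section of the new component can thus be added without disturbing the others. -/
theorem SplitsOnto.biproduct {J : Type*} [Finite J] {L : ModuleCat.{u} A}
    {X : J → ModuleCat.{u} A} (h : ∀ j, SplitsOnto L (X j)) : SplitsOnto L (⨁ X) := by
  classical
  have := Fintype.ofFinite J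
  intro f hf
  have key : ∀ s : Finset J, ∃ c : ⨁ X ⟶ L, ∀ j ∈ s, c ≫ f ≫ biproduct.π X j = biproduct.π X j := by
    intro s
    induction s using Finset.induction_on with
    | empty => exact ⟨0, by simp⟩
    | insert j₀ s hj₀ ih =>
      obtain ⟨c, hc⟩ := ih
      let r : ⨁ X ⟶ ⨁ X := ∑ j ∈ s, biproduct.π X j ≫ biproduct.ι X j
      have hr (j) (hj : j ∈ s) : r ≫ biproduct.π X j = biproduct.π X j := by
        rw [Preadditive.sum_comp, Finset.sum_eq_single j]
        · rw [Category.assoc, biproduct.ι_π_self, Category.comp_id]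
        · intro i _ hij
          rw [Category.assoc, biproduct.ι_π_ne _ hij, comp_zero]
        · exact fun h => absurd hj h
      have hr₀ : biproduct.ι X j₀ ≫ r = 0 := by
        rw [Preadditive.comp_sum]
        refine Finset.sum_eq_zero fun j hj => ?_
        rw [biproduct.ι_π_ne_assoc _ (by rintro rfl; exact hj₀ hj), zero_comp]
      let ε : L ⟶ L := 𝟙 L - f ≫ r ≫ c
      have hε (j) (hj : j ∈ s) : ε ≫ f ≫ biproduct.π X j = 0 := by
        simp only [ε, Preadditive.sub_comp, Category.id_comp, Category.assoc, hc j hj, hr j hj,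
          sub_self]
      obtain ⟨c', hc'⟩ := h j₀ (ε ≫ f ≫ biproduct.π X j₀) fun t => by
        obtain ⟨y, hy⟩ := hf (biproduct.ι X j₀ t)
        refine ⟨y, ?_⟩
        have h1 : ε y = y - c (r (f y)) := rfl
        have h2 : r (biproduct.ι X j₀ t) = 0 := congr($hr₀ t)
        have h3 : biproduct.π X j₀ (biproduct.ι X j₀ t) = t := congr($(biproduct.ι_π_self X j₀) t)
        change biproduct.π X j₀ (f (ε y)) = t
        rw [h1, hy, h2, map_zero, sub_zero, hy, h3]
      refine ⟨c + (biproduct.π X j₀ - c ≫ f ≫ biproduct.π X j₀) ≫ c' ≫ ε, fun j hj => ?_⟩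
      simp only [Preadditive.add_comp, Category.assoc]
      obtain rfl | hj := Finset.mem_insert.1 hj
      · rw [hc', Category.comp_id, add_sub_cancel]
      · rw [hε j hj, hc j hj, comp_zero, comp_zero, add_zero]
  obtain ⟨c, hc⟩ := key Finset.univ
  refine ⟨c, biproduct.hom_ext _ _ fun j => ?_⟩
  rw [Category.assoc, hc j (Finset.mem_univ j), Category.id_comp]

variable {Λ : Type w} [PartialOrder Λ] {Θ Q : Λ → ModuleCat.{u} A}

omit [PartialOrder Λ] in
theorem HasDistinctSimpleTops.eq_of_surjective (hT : HasDistinctSimpleTops Θ) {l m : Λ}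
    (f : Θ l ⟶ Θ m) (hf : Function.Surjective f) : l = m := by
  have := hT.isSimple l
  have := hT.isSimple m
  let φ : TopOf A (Θ l) →ₗ[A] TopOf A (Θ m) :=
    Submodule.mapQ _ _ f.hom (Module.le_comap_jacobson f.hom)
  have hφ : Function.Surjective φ := by
    intro x
    obtain ⟨x, rfl⟩ := Submodule.mkQ_surjective _ x
    obtain ⟨y, rfl⟩ := hf x
    exact ⟨Submodule.Quotient.mk y, rfl⟩
  have := IsSimpleModule.nontrivial A (TopOf A (Θ m))
  have h0 : φ ≠ 0 := by
    rintro h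
    obtain ⟨x, hx⟩ := exists_ne (0 : TopOf A (Θ m))
    obtain ⟨y, rfl⟩ := hφ x
    exact hx (by rw [h, LinearMap.zero_apply])
  exact hT.eq_of_iso l m ⟨LinearEquiv.ofBijective φ (LinearMap.bijective_of_ne_zero h0)⟩

-- Some `Θ m → L → Θ l` has image outside the radical of `Θ l`, which is maximal, so by Nakayama it
-- is onto. Distinct tops force `m = l`, and a surjective endomorphism of a Noetherian module is
-- invertible.
omit [PartialOrder Λ] in
theorem HasDistinctSimpleTops.splitsOnto [IsNoetherianRing A] (hT : HasDistinctSimpleTops Θ)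
    (hfin : ∀ l, Module.Finite A (Θ l)) {L : ModuleCat.{u} A} (hL : AddOf Θ Set.univ L) (l : Λ) :
    SplitsOnto L (Θ l) := by
  intro f hf
  have hJ : IsCoatom (Module.jacobson A (Θ l)) := isSimpleModule_iff_isCoatom.1 (hT.isSimple l)
  have hfl := hfin l
  obtain ⟨m, b, hb⟩ : ∃ m, ∃ b : Θ m ⟶ L, Function.Surjective (b ≫ f) := by
    by_contra! hcon
    have key : ∀ g ∈ through Θ Set.univ L L,
        LinearMap.range (g ≫ f).hom ≤ Module.jacobson A (Θ l) := by
      intro g hg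
      induction hg using AddSubgroup.closure_induction with
      | mem g hg =>
        obtain ⟨m, -, a, b, rfl⟩ := hg
        have h1 : LinearMap.range (b ≫ f).hom ≤ Module.jacobson A (Θ l) := by
          by_contra hnot
          refine hcon m b (LinearMap.range_eq_top.1 (eq_top_of_sup_jacobson _ ?_))
          exact hJ.2 _ (right_lt_sup.2 hnot)
        rintro _ ⟨x, rfl⟩
        exact h1 ⟨a x, rfl⟩
      | zero =>
        rw [zero_comp]
        rintro _ ⟨x, rfl⟩
        exact zero_mem _
      | add g g' _ _ hg hg' =>
        rintro _ ⟨x, rfl⟩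
        have : ((g + g') ≫ f).hom x = (g ≫ f).hom x + (g' ≫ f).hom x := by
          rw [Preadditive.add_comp]; rfl
        rw [this]
        exact add_mem (hg ⟨x, rfl⟩) (hg' ⟨x, rfl⟩)
      | neg g _ hg =>
        rintro _ ⟨x, rfl⟩
        have : ((-g) ≫ f).hom x = - (g ≫ f).hom x := by
          rw [Preadditive.neg_comp]; rfl
        rw [this]
        exact neg_mem (hg ⟨x, rfl⟩)
    have h1 := key _ hL
    rw [Category.id_comp, LinearMap.range_eq_top.2 hf, top_le_iff] at h1
    exact hJ.1 h1
  obtain rfl := hT.eq_of_surjective _ hb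
  have hbij : Function.Bijective (b ≫ f) :=
    ⟨IsNoetherian.injective_of_surjective_endomorphism (b ≫ f).hom hb, hb⟩
  have : IsIso (b ≫ f) := (ConcreteCategory.isIso_iff_bijective _).2 hbij
  exact ⟨inv (b ≫ f) ≫ b, by rw [Category.assoc, IsIso.inv_hom_id]⟩

/-! ### Covers by summands of sums of the modules `Q l` -/

omit [PartialOrder Λ] in
theorem AddOf.comp_eq_zero {B : Λ → ModuleCat.{u} A} {S : Set Λ} {W X L : ModuleCat.{u} A}
    (hL : AddOf B S L) (d : W ⟶ X) (hd : ∀ l ∈ S, ∀ f : X ⟶ B l, d ≫ f = 0) (h : X ⟶ L) :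
    d ≫ h = 0 := by
  have key : ∀ g ∈ through B S L L, d ≫ h ≫ g = 0 := by
    intro g hg
    induction hg using AddSubgroup.closure_induction with
    | mem g hg =>
      obtain ⟨l, hl, a, b, rfl⟩ := hg
      have := hd l hl (h ≫ a)
      rw [← Category.assoc h, ← Category.assoc, this, zero_comp]
    | zero => rw [comp_zero, comp_zero]
    | add g g' _ _ hg hg' => rw [Preadditive.comp_add, Preadditive.comp_add, hg, hg', add_zero]
    | neg g _ hg => rw [Preadditive.comp_neg, Preadditive.comp_neg, hg, neg_zero]
  simpa using key _ hL

/-- An endomorphism of a summand of a sum of `Q l` that is the identity modulo the morphisms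
to the `Θ l` is an isomorphism. -/
theorem isIso_of_forall_comp_eq {n i : ℕ} (hQ : ∀ l, Layered Θ n i (Q l)) {P : ModuleCat.{u} A}
    (hP : AddOf Q Set.univ P) (t : P ⟶ P) (ht : ∀ l (f : P ⟶ Θ l), t ≫ f = f) : IsIso t := by
  let d : End P := 𝟙 P - t
  have hd (l) (f : P ⟶ Θ l) : d ≫ f = 0 := by
    change (𝟙 P - t) ≫ f = 0
    rw [Preadditive.sub_comp, Category.id_comp, ht, sub_self]
  -- `d` kills maps into a layer, so each factor `d` pushes a map one term down the filtration; `n`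
  -- factors exhaust it.
  have key : ∀ (n i : ℕ) (M : ModuleCat.{u} A), Layered Θ n i M → ∀ g : P ⟶ M,
      (d ^ n : End P) ≫ g = 0 := by
    intro n
    induction n with
    | zero => exact fun i M hM g => hM.eq_of_tgt _ _
    | succ n ih =>
      rintro i M ⟨N, L, f, g', w, S, hL, hN⟩ g
      obtain ⟨k, hk⟩ := exact_lift S (d ≫ g)
        (by rw [Category.assoc]; exact hL.comp_eq_zero _ (fun l _ => hd l) _)
      have : (d ^ (n + 1) : End P) = (d ^ n : End P) ≫ d := by
        rw [pow_succ']
        rfl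
      rw [this, Category.assoc, ← hk, ← Category.assoc, ih _ _ hN, zero_comp]
  have hnil : IsNilpotent d := by
    refine ⟨n, ?_⟩
    have := hP.comp_eq_zero (d ^ n : End P) (fun l _ f => key n i _ (hQ l) f) (𝟙 P)
    rwa [Category.comp_id] at this
  have := hnil.isUnit_one_sub
  have h1 : (1 - d : End P) = t := sub_sub_cancel _ _
  rw [h1] at this
  exact (isUnit_iff_isIso t).1 this

variable [Fintype Λ]

variable (Θ Q) in
/-- An epimorphism from a summand of a sum of `Q l` along which all morphisms from such summands
lift, and through which all morphisms to `⨁ Θ` factor. -/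
structure IsGoodCover {P M : ModuleCat.{u} A} (q : P ⟶ M) : Prop where
  addOf : AddOf Q Set.univ P
  epi : Epi q
  lift (P' : ModuleCat.{u} A) (hP' : AddOf Q Set.univ P') (f : P' ⟶ M) : ∃ k, k ≫ q = f
  desc (f : P ⟶ ⨁ Θ) : ∃ g, q ≫ g = f

omit [PartialOrder Λ] in
theorem IsGoodCover.biproduct {J : Type*} [Finite J] {P M : J → ModuleCat.{u} A}
    {q : ∀ j, P j ⟶ M j} (h : ∀ j, IsGoodCover Θ Q (q j)) :
    IsGoodCover Θ Q (biproduct.map q) where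
  addOf := AddOf.biproduct P fun j => (h j).addOf
  epi := have := fun j => (h j).epi; inferInstance
  lift P' hP' f := by
    choose k hk using fun j => (h j).lift P' hP' (f ≫ biproduct.π M j)
    exact ⟨biproduct.lift k, biproduct.hom_ext _ _ fun j => by simp [hk]⟩
  desc f := by
    choose k hk using fun j => (h j).desc (biproduct.ι P j ≫ f)
    exact ⟨biproduct.desc k, biproduct.hom_ext' _ _ fun j => by simp [hk]⟩

section

variable {P M : ModuleCat.{u} A} {q : P ⟶ M}

omit [PartialOrder Λ] in
theorem IsGoodCover.comp_iso (h : IsGoodCover Θ Q q) {M' : ModuleCat.{u} A} (e : M ⟶ M') [IsIso e] :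
    IsGoodCover Θ Q (q ≫ e) where
  addOf := h.addOf
  epi := have := h.epi; inferInstance
  lift P' hP' f := by
    obtain ⟨k, hk⟩ := h.lift P' hP' (f ≫ inv e)
    exact ⟨k, by rw [reassoc_of% hk, IsIso.inv_hom_id, Category.comp_id]⟩
  desc f := by
    obtain ⟨g, hg⟩ := h.desc f
    exact ⟨inv e ≫ g, by simp [hg]⟩

omit [PartialOrder Λ] in
theorem IsGoodCover.desc_hom (h : IsGoodCover Θ Q q) (l : Λ) (f : P ⟶ Θ l) : ∃ g, q ≫ g = f := by
  obtain ⟨g, hg⟩ := h.desc (f ≫ biproduct.ι Θ l)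
  exact ⟨g ≫ biproduct.π Θ l, by rw [reassoc_of% hg, biproduct.ι_π_self, Category.comp_id]⟩

theorem IsGoodCover.isIso (h : IsGoodCover Θ Q q) {n i : ℕ} (hQ : ∀ l, Layered Θ n i (Q l))
    (t : P ⟶ P) (ht : t ≫ q = q) : IsIso t := by
  refine isIso_of_forall_comp_eq hQ h.addOf t fun l f => ?_
  obtain ⟨g, rfl⟩ := h.desc_hom l f
  rw [reassoc_of% ht]

end

/-- In a right minimal morphism `p` from a summand of a sum of `Q l`, with kernel a module whose
morphisms to `⨁ Θ` factor through a layer, the kernel does not cover any nonzero summand. -/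
theorem eq_zero_of_minimal [IsNoetherianRing A] (hT : HasDistinctSimpleTops Θ)
    (hfin : ∀ l, Module.Finite A (Θ l)) {n i : ℕ} (hQ : ∀ l, Layered Θ n i (Q l))
    {q : ∀ l, Q l ⟶ Θ l} (hq : ∀ l, IsGoodCover Θ Q (q l))
    {X P M : ModuleCat.{u} A} {ι : X ⟶ P} {p : P ⟶ M} (w : ι ≫ p = 0)
    (hP : InAdd Q P) (hp : ∀ g : P ⟶ P, g ≫ p = p → IsIso g)
    {N L : ModuleCat.{u} A} {f : N ⟶ X} {g : X ⟶ L} {w' : f ≫ g = 0}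
    (S : (ShortComplex.mk f g w').ShortExact) (hL : AddOf Θ Set.univ L) (hg : ExtSurj (⨁ Θ) g)
    (hN : ∀ P', AddOf Q Set.univ P' → ∀ x : Ext P' N 1, x = 0)
    (e : P ⟶ P) (he : e ≫ e = e) (hι : ∀ x : P, ∃ y : X, e (ι y) = e x) : e = 0 := by
  obtain ⟨m, ⟨R⟩⟩ := hP
  have hc := IsGoodCover.biproduct fun _ : Fin m => IsGoodCover.biproduct hq
  set c := biproduct.map fun _ : Fin m => biproduct.map q with hcdef
  have := hc.epi
  have hLT : AddOf Θ Set.univ (L ⊞ ⨁ fun _ : Fin m => ⨁ Θ) :=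
    hL.biprod (AddOf.biproduct _ fun _ => AddOf.biproduct _ fun l => AddOf.of_mem (Set.mem_univ l))
  -- The idempotent is transported to a sum of copies of `⨁ Q` containing `P` as a retract, where
  -- the good cover `c` is available.
  let ε := R.r ≫ e ≫ R.i
  have hε : ε ≫ ε = ε := by
    simp only [ε, Category.assoc, R.retract_assoc, reassoc_of% he]
  obtain ⟨u, hu⟩ : ∃ u, g ≫ u = ι ≫ e ≫ R.i ≫ c := by
    choose u hu using fun j => hg.exists_hom (𝟙 _) (𝟙 _) (Category.comp_id _)
      ((ι ≫ e ≫ R.i ≫ c) ≫ biproduct.π (fun _ : Fin m => ⨁ Θ) j)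
    exact ⟨biproduct.lift u, biproduct.hom_ext _ _ fun j => by
      rw [Category.assoc, biproduct.lift_π, hu]⟩
  obtain ⟨v, hv⟩ : ∃ v, c ≫ v = (𝟙 _ - ε) ≫ c := by
    choose v hv using fun j => hc.desc (((𝟙 _ - ε) ≫ c) ≫ biproduct.π (fun _ : Fin m => ⨁ Θ) j)
    exact ⟨biproduct.lift v, biproduct.hom_ext _ _ fun j => by
      rw [Category.assoc, biproduct.lift_π, hv]⟩
  -- By `hι` the part `ε` is already reached from `X`, hence through `u`; the part `1 - ε` is
  -- reached through `v`.
  have hsurj : Function.Surjective (biprod.desc u v) := by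
    intro t
    obtain ⟨z, rfl⟩ := (ModuleCat.epi_iff_surjective c).1 inferInstance t
    obtain ⟨y, hy⟩ := hι (R.r z)
    have h1 : g ≫ biprod.inl ≫ biprod.desc u v = ι ≫ e ≫ R.i ≫ c := by
      rw [biprod.inl_desc, hu]
    have h2 : c ≫ biprod.inr ≫ biprod.desc u v = (𝟙 _ - ε) ≫ c := by
      rw [biprod.inr_desc, hv]
    have h1' : biprod.desc u v (biprod.inl (C := ModuleCat.{u} A) (g y)) = c (R.i (e (ι y))) :=
      congr($h1 y)
    have h2' : biprod.desc u v (biprod.inr (C := ModuleCat.{u} A) (c z)) =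
      c (z - R.i (e (R.r z))) := congr($h2 z)
    refine ⟨biprod.inl (C := ModuleCat.{u} A) (g y) + biprod.inr (C := ModuleCat.{u} A) (c z), ?_⟩
    rw [map_add, h1', h2', hy, ← map_add, add_sub_cancel]
  obtain ⟨a, ha⟩ := SplitsOnto.biproduct (fun _ : Fin m => SplitsOnto.biproduct fun l =>
    hT.splitsOnto hfin hLT l) _ hsurj
  obtain ⟨σ, hσ⟩ := exact_lift_of_ext S (hN _ hc.addOf) (c ≫ a ≫ biprod.fst)
  obtain ⟨β, hβ⟩ := hc.lift _ hc.addOf (c ≫ a ≫ biprod.snd)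
  -- This lifts the splitting `a` from the modules `Θ` to the covers, so `W ≫ c = c` and `W` is
  -- invertible.
  let W := σ ≫ ι ≫ e ≫ R.i + β ≫ (𝟙 _ - ε)
  have hW : W ≫ c = c := by
    have h1 : a ≫ biprod.fst ≫ u + a ≫ biprod.snd ≫ v = 𝟙 _ := by
      rw [← ha, biprod.desc_eq, Preadditive.comp_add]
    calc W ≫ c = σ ≫ g ≫ u + β ≫ c ≫ v := by
          simp only [W, Preadditive.add_comp, Category.assoc, hu, hv]
      _ = c ≫ (a ≫ biprod.fst ≫ u + a ≫ biprod.snd ≫ v) := by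
          rw [reassoc_of% hσ, reassoc_of% hβ, Preadditive.comp_add]
      _ = c := by rw [h1, Category.comp_id]
  have := hc.isIso hQ W hW
  have hWε : W ≫ ε = σ ≫ ι ≫ e ≫ R.i := by
    simp only [W, Preadditive.add_comp, Category.assoc, Preadditive.sub_comp, Category.id_comp, hε,
      sub_self, comp_zero, add_zero]
    simp only [ε, R.retract_assoc, reassoc_of% he]
  have hε' : ε = inv W ≫ σ ≫ ι ≫ e ≫ R.i := by rw [← hWε, IsIso.inv_hom_id_assoc]
  -- `τ` lands in the kernel of `p` and `τ ≫ e = e`. Hence `𝟙 P - e ≫ τ` is invertible by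
  -- minimality, but its composite with `e` is zero.
  let τ := R.i ≫ inv W ≫ σ ≫ ι
  have hτe : τ ≫ e = e := by
    have h1 : R.i ≫ ε ≫ R.r = e := by
      simp only [ε, Category.assoc, R.retract_assoc, R.retract, Category.comp_id]
    conv_rhs => rw [← h1, hε']
    simp only [τ, Category.assoc, R.retract, Category.comp_id]
  have hτp : τ ≫ p = 0 := by simp only [τ, Category.assoc, w, comp_zero]
  have := hp (𝟙 P - e ≫ τ) (by
    rw [Preadditive.sub_comp, Category.assoc, hτp, comp_zero, sub_zero, Category.id_comp])
  rw [← cancel_epi (𝟙 P - e ≫ τ), Preadditive.sub_comp, Category.assoc, hτe, he, Category.id_comp,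
    sub_self, comp_zero]

end StratSystem

/-! ### Comparison of kernels, radicals and tops -/

namespace StratSystem

variable {A : Type u} [Ring A]

/-- The kernel of `P → M → L` maps onto the kernel `N` of `M → L`, with kernel `X`. -/
theorem exact_lift_comp {X P M N K L : ModuleCat.{u} A}
    {f : X ⟶ P} {p : P ⟶ M} {w : f ≫ p = 0} (S : (ShortComplex.mk f p w).ShortExact)
    {h : N ⟶ M} {π : M ⟶ L} {w' : h ≫ π = 0} (S' : (ShortComplex.mk h π w').ShortExact)
    {κ : K ⟶ P} {w'' : κ ≫ p ≫ π = 0} (S'' : (ShortComplex.mk κ (p ≫ π) w'').ShortExact) :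
    ∃ (a : X ⟶ K) (b : K ⟶ N) (w₀ : a ≫ b = 0), a ≫ κ = f ∧
      (ShortComplex.mk a b w₀).ShortExact := by
  have := exact_mono S'
  obtain ⟨a, ha⟩ := exact_lift S'' f (by rw [reassoc_of% w, zero_comp])
  obtain ⟨b, hb⟩ := exact_lift S' (κ ≫ p) (by rw [Category.assoc, w''])
  have ha' (x) : κ (a x) = f x := congr($ha x)
  have hb' (x) : h (b x) = p (κ x) := congr($hb x)
  refine ⟨a, b, ?_, ha, shortExact_of_apply (fun x y hxy => exact_inj S ?_) (fun n => ?_)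
    fun x hx => ?_⟩
  · rw [← cancel_mono h, Category.assoc, hb, reassoc_of% ha, w, zero_comp]
  · rw [← ha', hxy, ha']
  · obtain ⟨x, hx⟩ := exact_surj S (h n)
    have h1 : (p ≫ π) x = 0 := by
      change π (p x) = 0
      exact (congrArg π hx).trans congr($w' n)
    obtain ⟨k, rfl⟩ := exact_exists S'' h1
    exact ⟨k, exact_inj S' (by rw [hb', hx])⟩
  · have h1 : p (κ x) = 0 := by rw [← hb', hx, map_zero]
    obtain ⟨y, hy⟩ := exact_exists S h1
    exact ⟨y, exact_inj S'' (by rw [ha', hy])⟩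

theorem exact_comp_iso {X P M M' : ModuleCat.{u} A} {f : X ⟶ P} {p : P ⟶ M} {w : f ≫ p = 0}
    (S : (ShortComplex.mk f p w).ShortExact) (e : M ≅ M') :
    ∃ w, (ShortComplex.mk f (p ≫ e.hom) w).ShortExact :=
  ⟨by rw [reassoc_of% w, zero_comp], ShortComplex.shortExact_of_iso (S₁ := ShortComplex.mk f p w)
    (ShortComplex.isoMk (Iso.refl _) (Iso.refl _) e (by simp) (by simp)) S⟩

theorem AddOf.finite {Λ : Type w} [Finite Λ] {Q : Λ → ModuleCat.{u} A}
    (hQ : ∀ l, Module.Finite A (Q l)) [IsNoetherianRing A] {P : ModuleCat.{u} A}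
    (hP : AddOf Q Set.univ P) : Module.Finite A P := by
  refine ⟨?_⟩
  have key : ∀ g ∈ through Q Set.univ P P, (LinearMap.range g.hom).FG := by
    intro g hg
    induction hg using AddSubgroup.closure_induction with
    | mem g hg =>
      obtain ⟨l, -, a, b, rfl⟩ := hg
      have := hQ l
      have h1 : (LinearMap.range b.hom).FG := Submodule.fg_range _
      have : IsNoetherian A (LinearMap.range b.hom) := isNoetherian_of_fg_of_noetherian _ h1
      exact Submodule.FG.of_le h1 (by rintro _ ⟨x, rfl⟩; exact ⟨a x, rfl⟩)
    | zero =>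
      rw [ModuleCat.hom_zero, LinearMap.range_zero]
      exact Submodule.fg_bot
    | add g g' _ _ hg hg' =>
      exact Submodule.FG.of_le (hg.sup hg') (by
        rintro _ ⟨x, rfl⟩
        exact Submodule.add_mem_sup ⟨x, rfl⟩ ⟨x, rfl⟩)
    | neg g _ hg =>
      rw [ModuleCat.hom_neg, LinearMap.range_neg]
      exact hg
  have := key _ hP
  rwa [ModuleCat.hom_id, LinearMap.range_id] at this

/-- If the tops of `M` and `M ⧸ N` are isomorphic, then `N` is contained in the radical. -/
theorem le_jacobson_of_equiv {M : Type u} [AddCommGroup M] [Module A M] [IsNoetherian A M]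
    {L : Type v} [AddCommGroup L] [Module A L] (N : Submodule A M)
    (e : (M ⧸ N) ≃ₗ[A] L) (e' : TopOf A M ≃ₗ[A] TopOf A L) : N ≤ Module.jacobson A M := by
  let φ : TopOf A M →ₗ[A] TopOf A (M ⧸ N) :=
    Submodule.mapQ _ _ N.mkQ (Module.le_comap_jacobson N.mkQ)
  have hφ : Function.Surjective φ := by
    intro x
    obtain ⟨x, rfl⟩ := Submodule.mkQ_surjective _ x
    obtain ⟨y, rfl⟩ := Submodule.mkQ_surjective _ x
    exact ⟨Submodule.Quotient.mk y, rfl⟩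
  let ψ : TopOf A (M ⧸ N) ≃ₗ[A] TopOf A M :=
    (Submodule.Quotient.equiv _ _ e (Module.map_jacobson_of_bijective e.bijective)).trans e'.symm
  have hinj : Function.Injective (ψ.toLinearMap ∘ₗ φ) :=
    IsNoetherian.injective_of_surjective_endomorphism _ (ψ.surjective.comp hφ)
  intro x hx
  rw [← Submodule.Quotient.mk_eq_zero]
  apply hinj
  rw [map_zero, LinearMap.comp_apply]
  have : φ (Submodule.Quotient.mk x) = 0 := by
    change Submodule.Quotient.mk (N.mkQ x) = _
    rw [Submodule.mkQ_apply, (Submodule.Quotient.mk_eq_zero N).2 hx, Submodule.Quotient.mk_zero]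
  rw [this, map_zero]

variable {Λ : Type w} [PartialOrder Λ] {Θ Q : Λ → ModuleCat.{u} A}

omit [PartialOrder Λ] in
theorem isZero_of_hasFiltration_empty {S : Set Λ} (hS : ∀ l, l ∉ S) {M : ModuleCat.{u} A}
    (h : HasFiltration Θ S M) : IsZero M :=
  h.induction (P := IsZero) (fun _ h => h) (fun e h => h.of_iso e.symm)
    fun _ _ _ _ _ ⟨l, hl, _⟩ => absurd hl (hS l)

/-- A quotient isomorphic to a layer is a biproduct. -/
theorem nonempty_iso_biproduct [Finite Λ] {i : ℕ} {m : Λ → ℕ} {M : ModuleCat.{u} A}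
    (e : M ≃ₗ[A] LayerSum Θ i m) :
    Nonempty ((⨁ fun j : (Σ l : {l : Λ // ht l = i}, Fin (m l)) => Θ j.1) ≅ M) := by
  classical
  have := Fintype.ofFinite Λ
  let J := Σ l : {l : Λ // ht l = i}, Fin (m l)
  let π (j : J) : M ⟶ Θ j.1 :=
    ModuleCat.ofHom (LinearMap.proj j.2 ∘ₗ LinearMap.proj j.1 ∘ₗ e.toLinearMap)
  let ι (j : J) : ModuleCat.of A (Θ j.1) ⟶ M :=
    ModuleCat.ofHom (e.symm.toLinearMap ∘ₗ
      LinearMap.single A (fun l : {l : Λ // ht l = i} => Fin (m l) → Θ l) j.1 ∘ₗ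
      LinearMap.single A (fun _ : Fin (m j.1) => Θ j.1) j.2)
  let b : Bicone fun j : J => Θ j.1 :=
    { pt := M
      π := π
      ι := ι
      ι_π := by
        rintro ⟨l, a⟩ ⟨l', a'⟩
        ext x
        change e (e.symm (Pi.single l (Pi.single a x))) l' a' = _
        rw [e.apply_symm_apply]
        by_cases hl : l = l'
        · subst hl
          rw [Pi.single_eq_same]
          by_cases ha : a = a'
          · subst ha
            rw [Pi.single_eq_same, dif_pos rfl]
            rfl
          · have hne : (⟨l, a⟩ : J) ≠ ⟨l, a'⟩ := fun h => ha (eq_of_heq (Sigma.mk.inj_iff.1 h).2)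
            rw [Pi.single_eq_of_ne (Ne.symm ha)]
            split_ifs with h
            · exact absurd h hne
            · rfl
        · have hne : (⟨l, a⟩ : J) ≠ ⟨l', a'⟩ := fun h => hl (congrArg Sigma.fst h)
          rw [Pi.single_eq_of_ne (Ne.symm hl)]
          split_ifs with h
          · exact absurd h hne
          · rfl }
  have hb : ∑ j, b.π j ≫ b.ι j = 𝟙 b.pt := by
    ext x
    rw [ModuleCat.hom_sum, LinearMap.sum_apply]
    apply e.injective
    rw [map_sum, Fintype.sum_sigma]
    change ∑ l, ∑ a, e (e.symm (Pi.single l (Pi.single a (e x l a)))) = e x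
    simp only [e.apply_symm_apply]
    ext l a
    simp only [Finset.sum_apply]
    rw [Finset.sum_eq_single l, Finset.sum_eq_single a]
    · rw [Pi.single_eq_same, Pi.single_eq_same]
    · intro a' _ ha
      rw [Pi.single_eq_same, Pi.single_eq_of_ne (Ne.symm ha)]
    · simp
    · intro l' _ hl
      refine Finset.sum_eq_zero fun a' _ => ?_
      rw [Pi.single_eq_of_ne (Ne.symm hl)]
      rfl
    · simp
  exact ⟨(biproduct.uniqueUpToIso _ (isBilimitOfTotal b hb)).symm⟩

/-- The simple top of `Θ l` is the top of a nonzero sum of `Θ l'` of height `i`, hence maps onto the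
top of one of them; distinctness gives `l' = l`. -/
theorem GeneratedInHeight.eq_ht (hT : HasDistinctSimpleTops Θ) {i : ℕ} {M : ModuleCat.{u} A}
    (h : GeneratedInHeight Θ i M) {l : Λ} (e : M ≅ Θ l) : i = ht l := by
  obtain ⟨N, m, -, -, ⟨e'⟩⟩ := h
  have hl := hT.isSimple l
  have e₁ : TopOf A (Θ l) ≃ₗ[A] TopOf A (LayerSum Θ i m) :=
    (Submodule.Quotient.equiv _ _ e.toLinearEquiv.symm
      (Module.map_jacobson_of_bijective e.toLinearEquiv.symm.bijective)).trans e'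
  have := IsSimpleModule.nontrivial A (TopOf A (Θ l))
  have hnt : Nontrivial (LayerSum Θ i m) := by
    by_contra h
    rw [not_nontrivial_iff_subsingleton] at h
    exact not_subsingleton _ (e₁.toEquiv.subsingleton)
  obtain ⟨x, hx⟩ := exists_ne (0 : LayerSum Θ i m)
  obtain ⟨l', hl'⟩ := Function.ne_iff.1 hx
  obtain ⟨a, -⟩ := Function.ne_iff.1 hl'
  let pr : LayerSum Θ i m →ₗ[A] Θ l' := LinearMap.proj a ∘ₗ LinearMap.proj l'
  have hpr : Function.Surjective pr := by
    classical
    intro x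
    refine ⟨Pi.single l' (Pi.single a x), ?_⟩
    change (Pi.single l' (Pi.single a x) : LayerSum Θ i m) l' a = x
    rw [Pi.single_eq_same, Pi.single_eq_same]
  let φ : TopOf A (LayerSum Θ i m) →ₗ[A] TopOf A (Θ l') :=
    Submodule.mapQ _ _ pr (Module.le_comap_jacobson pr)
  have hφ : Function.Surjective φ := by
    intro x
    obtain ⟨x, rfl⟩ := Submodule.mkQ_surjective _ x
    obtain ⟨y, rfl⟩ := hpr x
    exact ⟨Submodule.Quotient.mk y, rfl⟩
  have hl₁ := hT.isSimple l'
  have := IsSimpleModule.nontrivial A (TopOf A (Θ l'))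
  have hne : φ ∘ₗ e₁.toLinearMap ≠ 0 := by
    intro h
    obtain ⟨x, hx⟩ := exists_ne (0 : TopOf A (Θ l'))
    obtain ⟨y, rfl⟩ := (hφ.comp e₁.surjective) x
    exact hx congr($h y)
  rw [hT.eq_of_iso l l' ⟨LinearEquiv.ofBijective _ (LinearMap.bijective_of_ne_zero hne)⟩]
  exact l'.2.symm

end StratSystem

/-! ### Linearly filtered modules are linearly layered -/

namespace StratSystem

variable {A : Type u} [Ring A] {Λ : Type w} [PartialOrder Λ] [Fintype Λ]
  {Θ Q : Λ → ModuleCat.{u} A}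

omit [PartialOrder Λ] in
/-- A right minimal epimorphism from an object of `add Q` onto a module with a good cover is a
good cover. -/
theorem IsGoodCover.of_minimal {Q' P K M : ModuleCat.{u} A} {q : Q' ⟶ M}
    (hq : IsGoodCover Θ Q q) {f : K ⟶ P} {p : P ⟶ M} {w : f ≫ p = 0}
    (S : (ShortComplex.mk f p w).ShortExact) (hP : AddOf Q Set.univ P)
    (hK : ∀ P', AddOf Q Set.univ P' → ∀ x : Ext P' K 1, x = 0)
    (hp : ∀ g : P ⟶ P, g ≫ p = p → IsIso g) : IsGoodCover Θ Q p where
  addOf := hP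
  epi := exact_epi S
  lift P' hP' f := exact_lift_of_ext S (hK P' hP') f
  desc f := by
    -- The two covers lift through each other, and `b ≫ a` is invertible by minimality; this carries
    -- the factorization property from `q` to `p`.
    obtain ⟨a, ha⟩ := exact_lift_of_ext S (hK _ hq.addOf) q
    obtain ⟨b, hb⟩ := hq.lift P hP p
    have hab : (b ≫ a) ≫ p = p := by rw [Category.assoc, ha, hb]
    have := hp _ hab
    obtain ⟨g, hg⟩ := hq.desc (a ≫ f)
    refine ⟨g, ?_⟩
    rw [← cancel_epi (b ≫ a), ← Category.assoc, hab, Category.assoc, ← hg, reassoc_of% hb]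

variable (Θ Q) in
/-- The consequences of the hypotheses on an Ext-projective stratifying system that are used to
describe linearly filtered modules. -/
structure IsGoodSystem (q : ∀ l, Q l ⟶ Θ l) (H : ℕ) : Prop where
  directed : HeightDirected Θ
  ht_le (l : Λ) : ht l ≤ H
  tops : HasDistinctSimpleTops Θ
  finite_theta (l : Λ) : Module.Finite A (Θ l)
  finite_q (l : Λ) : Module.Finite A (Q l)
  isGoodCover (l : Λ) : IsGoodCover Θ Q (q l)
  layered_q (l : Λ) : Layered Θ H 1 (Q l)
  ext_eq_zero (l m : Λ) (i : ℕ) (hi : 1 ≤ i) (x : Ext (Q l) (Θ m) i) : x = 0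

theorem exact_quotient {M : ModuleCat.{u} A} (N : Submodule A M) :
    ∃ w, (ShortComplex.mk (ModuleCat.ofHom N.subtype) (ModuleCat.ofHom N.mkQ) w).ShortExact :=
  ⟨by ext x; exact (Submodule.Quotient.mk_eq_zero N).2 x.2,
    shortExact_of_apply Subtype.val_injective N.mkQ_surjective fun x hx =>
      ⟨⟨x, (Submodule.Quotient.mk_eq_zero N).1 hx⟩, rfl⟩⟩

omit [Fintype Λ] in
/-- A linearly layered module has a top layer. -/
theorem LinearlyLayered.exists_exact {T : ModuleCat.{u} A} {n i : ℕ} {M : ModuleCat.{u} A}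
    (h : LinearlyLayered Θ T level n i M) :
    ∃ (N L : ModuleCat.{u} A) (f : N ⟶ M) (g : M ⟶ L) (w : f ≫ g = 0) (n' i' : ℕ),
      (ShortComplex.mk f g w).ShortExact ∧ AddOf Θ Set.univ L ∧ ExtSurj T g ∧
        Layered Θ n' i' N := by
  have key : ∀ n, LinearlyLayered Θ T level (n + 1) i M →
      ∃ (N L : ModuleCat.{u} A) (f : N ⟶ M) (g : M ⟶ L) (w : f ≫ g = 0) (n' i' : ℕ),
        (ShortComplex.mk f g w).ShortExact ∧ AddOf Θ Set.univ L ∧ ExtSurj T g ∧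
          Layered Θ n' i' N := by
    rintro n ⟨N, L, f, g, w, S, hL, hg, hN⟩
    exact ⟨N, L, f, g, w, n, i + 1, S, hL.mono (Set.subset_univ _), hg, hN.layered⟩
  cases n with
  | zero => exact key 0 (.of_isZero h 1 i)
  | succ n => exact key n h

namespace IsGoodSystem

variable {q : ∀ l, Q l ⟶ Θ l} {H : ℕ} (C : IsGoodSystem Θ Q q H)
include C

theorem ext_layered_eq_zero {P M : ModuleCat.{u} A} (hP : AddOf Q Set.univ P) {n i : ℕ}
    (hM : Layered Θ n i M) (x : Ext P M 1) : x = 0 :=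
  hP.ext_eq_zero' (fun l _ => hM.ext_eq_zero_of_forall fun m => C.ext_eq_zero l m 1 le_rfl) x

theorem ext_biproduct_eq_zero {P : ModuleCat.{u} A} (hP : AddOf Q Set.univ P) {t : ℕ} (ht : 1 ≤ t)
    (x : Ext P (⨁ Θ) t) : x = 0 :=
  hP.ext_eq_zero' (fun l _ => (AddOf.biproduct _ fun m => AddOf.of_mem (Set.mem_univ m)).ext_eq_zero
    fun m _ => C.ext_eq_zero l m t ht) x

theorem layered_of_hasFiltration {S : Set Λ} {M : ModuleCat.{u} A} (h : HasFiltration Θ S M) :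
    Layered Θ H 1 M :=
  C.directed.layered_of_hasFiltration
    (fun l _ => ⟨Nat.le_add_left _ _, by have := C.ht_le l; omega⟩) h

theorem exists_cover {M K : ModuleCat.{u} A} (h : IsRelSyzygy Θ Q M K) :
    ∃ (P : ModuleCat.{u} A) (f : K ⟶ P) (p : P ⟶ M) (w : f ≫ p = 0),
      (ShortComplex.mk f p w).ShortExact ∧ InAdd Q P ∧ (∀ g : P ⟶ P, g ≫ p = p → IsIso g) ∧
        Layered Θ H 1 K := by
  obtain ⟨P, p, hp, ⟨e⟩⟩ := h
  obtain ⟨w, S⟩ := exists_shortExact p hp.surjective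
  refine ⟨P, e.hom ≫ ModuleCat.ofHom (LinearMap.ker p.hom).subtype, p,
    by rw [Category.assoc, w, comp_zero], ?_, hp.inAdd, hp.minimal,
    (C.layered_of_hasFiltration hp.ker_inF).of_iso e⟩
  exact ShortComplex.shortExact_of_iso (S₁ := ShortComplex.mk _ p w)
    (ShortComplex.isoMk e.symm (Iso.refl _) (Iso.refl _) (by simp) (by simp)) S

/-- The syzygies of `Θ l` must start at height `ht l` by `GeneratedInHeight.eq_ht`, so `ih` applies
to the first one. -/
theorem exists_goodCover {l : Λ} (h : IsLinearlyFiltered Θ Q (Θ l)) {n i : ℕ} (hl : ht l = i)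
    (ih : ∀ Z : ℕ → ModuleCat.{u} A, (∀ s, IsRelSyzygy Θ Q (Z s) (Z (s + 1))) →
      (∀ s, GeneratedInHeight Θ (i + 1 + s) (Z s)) →
      LinearlyLayered Θ (⨁ Θ) level n (i + 1) (Z 0)) :
    ∃ (K P : ModuleCat.{u} A) (f : K ⟶ P) (p : P ⟶ Θ l) (w : f ≫ p = 0),
      (ShortComplex.mk f p w).ShortExact ∧ IsGoodCover Θ Q p ∧
        LinearlyLayered Θ (⨁ Θ) level n (i + 1) K := by
  obtain ⟨-, j, Z, ⟨e⟩, hZ, hG⟩ := h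
  have hj : j = i := by rw [← hl]; exact (hG 0).eq_ht C.tops e
  subst hj
  obtain ⟨P, f, p, w, S, hP, hp, hK⟩ := C.exists_cover (hZ 0)
  obtain ⟨w', S'⟩ := exact_comp_iso S e
  refine ⟨Z 1, P, f, p ≫ e.hom, w', S', (C.isGoodCover l).of_minimal S' hP.addOf
    (fun P' hP' => C.ext_layered_eq_zero hP' hK) (fun g hg => hp g ?_),
    ih (fun s => Z (s + 1)) (fun s => hZ (s + 1)) fun s => ?_⟩
  · rwa [← Category.assoc, cancel_mono] at hg
  · have := hG (s + 1)
    rwa [← add_assoc, add_right_comm] at this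

/-- Induction on the number `n` of remaining heights, applied one height up both to the syzygy of `Z
0` and to the syzygies of the `Θ l` in its top layer. -/
theorem linearlyLayered [IsNoetherianRing A] (hLin : ∀ l, IsLinearlyFiltered Θ Q (Θ l)) (n i : ℕ)
    (hn : H < i + n) (Z : ℕ → ModuleCat.{u} A) (hZ : ∀ s, IsRelSyzygy Θ Q (Z s) (Z (s + 1)))
    (hG : ∀ s, GeneratedInHeight Θ (i + s) (Z s)) :
    LinearlyLayered Θ (⨁ Θ) level n i (Z 0) := by
  induction n generalizing i Z with
  | zero =>
    obtain ⟨N, m, hN, ⟨e⟩, -⟩ := hG 0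
    obtain ⟨w, S⟩ := exact_quotient N
    -- No height reaches `i`, so both `N` and the top layer vanish.
    have hi (l : Λ) : ht l < i := (C.ht_le l).trans_lt hn
    have : IsEmpty {l : Λ // ht l = i + 0} := ⟨fun l => (hi l.1).ne l.2⟩
    have := e.toEquiv.subsingleton
    exact isZero_of_exact S
      (isZero_of_hasFiltration_empty (fun l hl => (hi l).not_gt hl) hN)
      (ModuleCat.isZero_of_subsingleton _)
  | succ n ih =>
    obtain ⟨N, m, hN, ⟨eL⟩, ⟨eT⟩⟩ := hG 0
    obtain ⟨P, f, p, w, S, hP, hmin, hXl⟩ := C.exists_cover (hZ 0)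
    have ih' := ih (i + 1) (by omega)
    have hX : LinearlyLayered Θ (⨁ Θ) level n (i + 1) (Z 1) :=
      ih' (fun s => Z (s + 1)) (fun s => hZ (s + 1)) fun s => by
        have := hG (s + 1)
        rwa [← add_assoc, add_right_comm] at this
    have := AddOf.finite C.finite_q hP.addOf
    have : Module.Finite A (Z 0) := Module.Finite.of_surjective p.hom (exact_surj S)
    have hNJ : N ≤ Module.jacobson A (Z 0) := le_jacobson_of_equiv N eL eT
    obtain ⟨wN, SN⟩ := exact_quotient N
    set π := ModuleCat.ofHom N.mkQ
    obtain ⟨eB⟩ := nonempty_iso_biproduct (M := ModuleCat.of A (Z 0 ⧸ N)) eL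
    choose K₁ P₁ f₁ p₁ w₁ S₁ hg₁ hK₁ using
      fun j : (Σ l : {l : Λ // ht l = i}, Fin (m l)) => C.exists_goodCover (hLin j.1) j.1.2 ih'
    obtain ⟨w₀, S₀⟩ := exact_biproduct S₁
    obtain ⟨w₀, S₀⟩ := exact_comp_iso S₀ eB
    have hg₀ := (IsGoodCover.biproduct hg₁).comp_iso eB.hom
    set p₀ := biproduct.map p₁ ≫ eB.hom
    have hY := LinearlyLayered.biproduct hK₁
    obtain ⟨r₁, hr₁⟩ := exact_lift_of_ext SN
      (C.ext_layered_eq_zero hg₀.addOf (C.layered_of_hasFiltration hN)) p₀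
    obtain ⟨r, rfl⟩ := exact_lift_of_ext S (C.ext_layered_eq_zero hg₀.addOf hXl) r₁
    -- It is onto modulo `N`, and `N` lies in the radical.
    have hr : Function.Surjective (r ≫ p).hom := by
      refine LinearMap.range_eq_top.1 (eq_top_of_sup_jacobson _ (top_le_iff.1 fun y _ => ?_))
      obtain ⟨z, hz⟩ := exact_surj S₀ (π y)
      have h1 : p₀ z = π ((r ≫ p) z) := congr($hr₁.symm z)
      have h2 : y - (r ≫ p) z ∈ N := (Submodule.Quotient.mk_eq_zero N).1 (by
        change π (y - (r ≫ p) z) = 0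
        rw [map_sub, ← h1, sub_eq_zero]
        exact hz.symm)
      rw [← add_sub_cancel ((r ≫ p) z) y]
      exact Submodule.add_mem_sup ⟨z, rfl⟩ (hNJ h2)
    obtain ⟨s, hs⟩ := hg₀.lift P hP.addOf (p ≫ π)
    have hrs : IsIso (r ≫ s) := hg₀.isIso C.layered_q _ (by
      rw [Category.assoc, hs, ← Category.assoc, hr₁])
    obtain ⟨t, ht⟩ : ∃ t, t = inv (r ≫ s) ≫ r := ⟨_, rfl⟩
    have hts : t ≫ s = 𝟙 _ := by rw [ht, Category.assoc, IsIso.inv_hom_id]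
    have hrst : r ≫ s ≫ t = r := by
      rw [ht, ← Category.assoc, IsIso.hom_inv_id_assoc]
    -- The complement of the sum of covers in `P` is the image of `𝟙 P - s ≫ t`. It is covered by `Z
    -- 1`, since the image of `r` already maps onto `Z 0`, and so it vanishes by right minimality.
    have hst : s ≫ t = 𝟙 P := by
      have hre : r ≫ (𝟙 P - s ≫ t) = 0 := by
        rw [Preadditive.comp_sub, hrst, Category.comp_id, sub_self]
      obtain ⟨N', L', f', g', w', n', i', S', hL', hg', hN'⟩ := hX.exists_exact
      have := eq_zero_of_minimal C.tops C.finite_theta C.layered_q C.isGoodCover w hP hmin S' hL'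
        hg' (fun P' hP' => C.ext_layered_eq_zero hP' hN') (𝟙 P - s ≫ t) (by
          simp only [Preadditive.comp_sub, Preadditive.sub_comp, Category.id_comp,
            Category.comp_id, Category.assoc, reassoc_of% hts, sub_self, sub_zero]) fun x => by
          obtain ⟨z, hz⟩ := hr (p x)
          have hz' : p (r z) = p x := hz
          obtain ⟨y, hy⟩ := exact_exists S (x := x - r z) (by
            rw [map_sub, hz', sub_self])
          refine ⟨y, ?_⟩
          have hy' : f y = x - r z := hy
          have hre' : (𝟙 P - s ≫ t) (r z) = 0 := congr($hre z)
          rw [hy', map_sub, hre', sub_zero]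
      exact (sub_eq_zero.1 this).symm
    obtain ⟨w₂, S₂⟩ := exact_of_iso S₀ (X := P) ⟨s, t, hst, hts⟩
    have S₂' : ∃ (κ : ⨁ K₁ ⟶ P) (w₂ : κ ≫ p ≫ π = 0), (ShortComplex.mk κ (p ≫ π) w₂).ShortExact :=
      ⟨_, by rw [← hs]; exact w₂, by convert S₂ using 2; exact hs.symm⟩
    obtain ⟨κ, w₂, S₂⟩ := S₂'
    -- With `P` covering both `Z 0` and its top layer, the kernels give `0 → Z 1 → ⨁ K₁ → N → 0`.
    obtain ⟨a, b, w₃, haκ, S₃⟩ := exact_lift_comp S SN S₂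
    obtain ⟨hNL, ha⟩ := C.directed.linearlyLayered_cokernel S₃ hX hY
      (C.directed.layered_of_hasFiltration (fun l hl => by
        have := C.ht_le l
        simp only [Set.mem_ofPred_eq] at hl
        omega) hN)
    refine ⟨_, _, _, π, wN, SN,
      (AddOf.biproduct _ fun j => AddOf.of_mem j.1.2).of_iso eB, fun d x => ?_, hNL⟩
    cases d with
    | zero =>
      obtain ⟨h, rfl⟩ := (Ext.mk₀_bijective _ _).2 x
      obtain ⟨g, hg⟩ := hg₀.desc (t ≫ p ≫ h)
      have := exact_epi S
      refine ⟨Ext.mk₀ g, ?_⟩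
      rw [Ext.mk₀_comp_mk₀]
      congr 1
      rw [← cancel_epi p, ← Category.assoc, ← hs, Category.assoc, hg, reassoc_of% hst]
    | succ d =>
      -- A class of positive degree is a connecting image from `Z 1`; it extends to `⨁ K₁`, whose
      -- connecting map lands in the extensions of the top layer.
      obtain ⟨y, rfl⟩ := Ext.contravariant_sequence_exact₃ S (⨁ Θ) x
        (C.ext_biproduct_eq_zero hP.addOf (Nat.le_add_left 1 d) _) (add_comm 1 d)
      obtain ⟨z, rfl⟩ := ha d y
      exact ⟨_, extClass_naturality_assoc S S₂ (a := a) (b := 𝟙 P) (c := π)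
        (by rw [haκ, Category.comp_id]) (by rw [Category.id_comp]) z (add_comm 1 d)⟩

end IsGoodSystem

end StratSystem

/-! ### From the stratifying system to the theorem -/

namespace StratSystem

variable {A : Type u} [Ring A] {Λ : Type w} [PartialOrder Λ] [Fintype Λ]
  {Θ Q : Λ → ModuleCat.{u} A}

theorem IsEPSS.isGoodSystem (k : Type v) [Field k] [Algebra k A] [Module.Finite k A]
    (hEPSS : IsEPSS Θ Q) (hTop : HasDistinctSimpleTops Θ)
    (hExt : ∀ i : ℕ, 1 ≤ i → ∀ x : Ext (⨁ Q) (⨁ Θ) i, x = 0)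
    (e : (⨁ Q ⟶ ⨁ Θ) ≃+ (⨁ Θ ⟶ ⨁ Θ))
    (he : ∀ (f : ⨁ Q ⟶ ⨁ Θ) (g : ⨁ Θ ⟶ ⨁ Θ), e (f ≫ g) = e f ≫ g) :
    ∃ (q : ∀ l, Q l ⟶ Θ l) (H : ℕ), IsGoodSystem Θ Q q H := by
  choose p hp hK using hEPSS.exists_sequence
  have hepi (l) : Epi (p l) := (ModuleCat.epi_iff_surjective _).2 (hp l)
  have hfin := hEPSS.finite_theta
  have hQΘ (l m : Λ) (i : ℕ) (hi : 1 ≤ i) (x : Ext (Q l) (Θ m) i) : x = 0 := by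
    have h₁ : AddOf (fun _ : Unit => ⨁ Q) Set.univ (Q l) :=
      (AddOf.of_mem (Set.mem_univ ())).of_retract (biproduct.ι Q l) (biproduct.π Q l)
        (biproduct.ι_π_self Q l)
    have h₂ : AddOf (fun _ : Unit => ⨁ Θ) Set.univ (Θ m) :=
      (AddOf.of_mem (Set.mem_univ ())).of_retract (biproduct.ι Θ m) (biproduct.π Θ m)
        (biproduct.ι_π_self Θ m)
    exact h₁.ext_eq_zero' (fun _ _ => h₂.ext_eq_zero fun _ _ => hExt i hi) x
  have hhom (l m : Λ) (h : ht m < ht l) (f : Θ l ⟶ Θ m) : f = 0 :=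
    hEPSS.hom_eq_zero l m (fun hlm => h.not_ge (ht_strictMono.monotone hlm)) f
  -- `Ext^1(Θ l, Θ m)` is a quotient of `Hom(K l, Θ m)`, with `K l` the kernel of `p l`. The factors
  -- of `K l` have height above `ht l`, so this Hom vanishes when `ht m ≤ ht l`.
  have D : HeightDirected Θ := by
    refine ⟨hhom, fun l m h x => ?_⟩
    obtain ⟨w, S⟩ := exists_shortExact (p l) (hp l)
    obtain ⟨y, rfl⟩ := Ext.contravariant_sequence_exact₃ S (Θ m) x (hQΘ l m 1 le_rfl _) (add_zero 1)
    obtain ⟨f, rfl⟩ := (Ext.mk₀_bijective _ _).2 y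
    have hf := (hK l).induction (P := fun K => ∀ f : K ⟶ Θ m, f = 0) (fun K hK f => hK.eq_of_src _ _)
      (fun e h f => by rw [← cancel_epi e.hom, h (e.hom ≫ f), comp_zero])
      fun f g w S hN ⟨l', hl', ⟨e⟩⟩ => exact_hom_eq_zero' S hN fun f => by
        rw [← cancel_epi e.inv, comp_zero]
        exact hhom _ _ (h.trans_lt (ht_strictMono hl')) _
    rw [hf f, Ext.mk₀_zero, Ext.comp_zero]
  have hH (l : Λ) : ht l ≤ Finset.univ.sup (ht : Λ → ℕ) := Finset.le_sup (Finset.mem_univ l)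
  have hlay {S : Set Λ} {M : ModuleCat.{u} A} (h : HasFiltration Θ S M) :
      Layered Θ (Finset.univ.sup (ht : Λ → ℕ)) 1 M :=
    D.layered_of_hasFiltration (fun l _ => ⟨Nat.le_add_left _ _, by have := hH l; omega⟩) h
  refine ⟨p, Finset.univ.sup ht, D, hH, hTop, hfin, hEPSS.finite_q, fun l => ?_, fun l => ?_, hQΘ⟩
  · obtain ⟨w, S⟩ := exists_shortExact (p l) (hp l)
    exact ⟨AddOf.of_mem (Set.mem_univ l), hepi l,
      fun P' hP' f => exact_lift_of_ext S (hP'.ext_eq_zero' fun m _ =>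
        (hlay (hK l)).ext_eq_zero_of_forall fun m' => hQΘ m m' 1 le_rfl) f,
      YonedaExt.exists_comp_eq k p e he l⟩
  · obtain ⟨w, S⟩ := exists_shortExact (p l) (hp l)
    exact D.layered_of_exact S (hlay (hK l))
      (HeightDirected.layered_of_mem l _ 1 (Nat.le_add_left _ _) (by have := hH l; omega))

end StratSystem

open YonedaExt StratSystem in
/-- Here `Θ l` and `Q l` are the members of the system; the modules `⨁ Θ` and `⨁ Q` are written
`biproduct Θ` and `biproduct Q`. -/
theorem theorem2p12 {k : Type v} [Field k] {A : Type u} [Ring A] [Algebra k A]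
    [Module.Finite k A] {Λ : Type w} [PartialOrder Λ] [Fintype Λ]
    (Θ Q : Λ → ModuleCat.{u} A) (hEPSS : IsEPSS Θ Q) (hTop : HasDistinctSimpleTops Θ)
    (hExt : ∀ i : ℕ, 1 ≤ i → ∀ x : Ext (biproduct Q) (biproduct Θ) i, x = 0)
    (hHom : ∃ e : (biproduct Q ⟶ biproduct Θ) ≃+ (biproduct Θ ⟶ biproduct Θ),
      ∀ (f : biproduct Q ⟶ biproduct Θ) (g : biproduct Θ ⟶ biproduct Θ),
        e (f ≫ g) = e f ≫ g)
    (hLin : ∀ l : Λ, IsLinearlyFiltered Θ Q (Θ l)) :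
    (∀ M : ModuleCat.{u} A, InF Θ M → IsLinearlyFiltered Θ Q M →
      HasLinearProjectiveResolution (algPart k (biproduct Θ)) (modPart M (biproduct Θ))) ∧
    IsGeneralizedKoszul k (algPart k (biproduct Θ)) := by
  obtain ⟨e, he⟩ := hHom
  obtain ⟨q, H, C⟩ := hEPSS.isGoodSystem k hTop hExt e he
  have : IsNoetherianRing A := isNoetherian_of_tower k inferInstance
  have := C.finite_theta
  constructor
  · rintro M - ⟨-, i, Z, ⟨eM⟩, hZ, hG⟩
    -- The length `H + 1` exceeds the number of heights left, whatever the starting height `i`.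
    have hM := C.linearlyLayered hLin (H + 1) i (by omega) Z hZ hG
    exact hasLinearProjectiveResolution k
      ((hM.of_iso eM.symm).mono (fun _ => Set.subset_univ _) 0)
  · have := finite_biproduct Θ
    refine ⟨finite_algPart k _, ?_⟩
    choose K P f p w S hp hK using fun l => C.exists_goodCover (hLin l) rfl
      (C.linearlyLayered hLin H (ht l + 1) (by omega))
    have hepi := fun l => exact_epi (S l)
    have hP : IsGoodCover Θ Q (biproduct.map p) := .biproduct hp
    refine hasLinearProjectiveResolution_zero k (biproduct.map p) hP.desc
      (fun i hi => C.ext_biproduct_eq_zero hP.addOf hi) ?_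
    refine hasLinearProjectiveResolution k (n := H + 1) (LinearlyLayered.biproduct fun l => ?_)
    -- `P l` has top layer `Θ l`: in degree zero its maps to `⨁ Θ` factor through `p l`, and in
    -- positive degrees its extensions by `⨁ Θ` vanish.
    refine ⟨K l, Θ l, f l, p l, w l, S l, AddOf.of_mem (Set.mem_univ l), fun t x => ?_,
      (hK l).mono (fun _ => Set.subset_univ _) 1⟩
    cases t with
    | zero =>
      obtain ⟨h, rfl⟩ := (Ext.mk₀_bijective _ _).2 x
      obtain ⟨g, rfl⟩ := (hp l).desc h
      exact ⟨Ext.mk₀ g, Ext.mk₀_comp_mk₀ _ _⟩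
    | succ t =>
      exact ⟨0, by rw [Ext.comp_zero, C.ext_biproduct_eq_zero (hp l).addOf (Nat.le_add_left 1 t) x]⟩
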